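/- **Theorem 4 (Shadow surrogation guarantee).** Let $U(\boldsymbol\alpha)=\prod_{i=1}^m C_i\,e^{-i\alpha_iP_i/2}$ be an $n$-qubit circuit with fixed Clifford unitaries $C_i$ and Pauli strings $P_i\in\{I,X,Y,Z\}^{\otimes n}$, let $O=\sum_P a_PP$ be an observable with real coefficients, $N_{\rm Paulis}$ of which are non-zero, with $\|a\|_1\le A$, and let $f(\boldsymbol\alpha)=\mathrm{Tr}[O\,U(\boldsymbol\alpha)\rho U(\boldsymbol\alpha)^\dagger]$ for an unknown state $\rho$. Let $0<r\le c/\sqrt m$, and let $\boldsymbol\alpha$ be uniform on $[-r,r]^m$. Here $A,c>0$ are constants. Back-propagating a Pauli string $Q$ layer by layer ($M\mapsto M'=C_i^\dagger MC_i$; then $M'$ is kept if it commutes with $P_i$, and otherwise branches into $\cos(\alpha_i)M'+\sin(\alpha_i)\tfrac i2[P_i,M']$) gives $U(\boldsymbol\alpha)^\dagger Q\,U(\boldsymbol\alpha)=\sum_\omega\Phi_\omega(\boldsymbol\alpha)Q_\omega$, a sum over Pauli paths $\omega$. For $\kappa\ge1$ let $\widetilde O_\kappa(\boldsymbol\alpha)=\sum_Qa_Q\sum_{\omega:\,\#\sin(\omega)\le\kappa}\Phi_\omega(\boldsymbol\alpha)Q_\omega=\sum_Pc_P(\boldsymbol\alpha)P$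 be the truncated back-propagated observable. Call $\kappa\geq 1$ *sufficient* for $\epsilon>0$ if $mr^2\le3\kappa$ and $4\|a\|_1^2\big(\tfrac{e\,m\,r^2}{3\kappa}\big)^{\kappa}\le\epsilon$. A *randomized Pauli measurement* measures each qubit of a fresh copy of $\rho$ in an independent, uniformly random basis among $X,Y,Z$. We say that *$N_s$ measurements suffice at order $\kappa$* if there are estimates $\hat o_P$, which are functions of the record of the $N_s$ measurements and do not depend on $\rho$, such that for every state $\rho$, with probability at least $1-\delta$ over the measurements, $$\mathbb E_{\boldsymbol\alpha}\Big[\Big(\sum_Pc_P(\boldsymbol\alpha)\,\hat o_P-f(\boldsymbol\alpha)\Big)^2\Big]\le\epsilon .$$ 1. *(Classical cost.)* There is $\epsilon_0>0$, depending only on $A,c$, such that for every $0<\epsilon\le\epsilon_0$ there is $\kappa$, depending only on $A,c,\epsilon$, such that for all such circuits, observables and $r$ with $m\ge1$: $\kappa$ is sufficient for $\epsilon$, and the cost of the truncated propagation ($m$ times the number of retained paths, summed over the Pauli terms of $O$) is at most $3N_{\rm Paulis}\,m^{\log(1/\epsilon)}$, and at most $N_{\rm Paulis}\,m\,(em/\kappa)^\kappa$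 if $\kappa\le m$. 2. *(Constant-weight back-propagated observables.)* For every $k$ there is $K>0$, depending only on $A,c,k$, such that for all such data with $n\ge2$, $m\,N_{\rm Paulis}\ge2$, $\epsilon>0$, $0<\delta\le\frac12$, and every $\kappa$ that is sufficient for $\epsilon$ and for which $\widetilde O_\kappa(\boldsymbol\alpha)$ contains only Pauli strings of weight at most $k$ for all $\boldsymbol\alpha\in[-r,r]^m$, every $$N_s\ \ge\ K\,\min\big(\log n,\ \log(m\,N_{\rm Paulis})\big)\,\frac{\log(1/\delta)}{\epsilon}$$ measurements suffice at order $\kappa$. 3. *(Single-qubit Cliffords and local rotations.)* For all $w,l$ there is $K>0$, depending only on $A,c,w,l$, such that for all such data with $n\ge2$, $m\,N_{\rm Paulis}\ge2$, $\epsilon>0$, $0<\delta\le\frac12$, and every $\kappa$ that is sufficient for $\epsilon$: if every $C_i$ is a tensor product of single-qubit Clifford gates, every $P_i$ has weight at most $l$, and $O$ contains only Pauli strings of weight at most $w$, then $\widetilde O_\kappa(\boldsymbol\alpha)$ contains only Pauli strings of weight at most $w+\kappa l$ for all $\boldsymbol\alpha$, and every $N_s\ge K\min(\log n,\log(m\,N_{\rm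 Paulis}))\log(1/\delta)/\epsilon$ measurements suffice at order $\kappa$. -/

import Mathlib

namespace ShadowSurrogation

open scoped Matrix ComplexOrder

noncomputable section

/-- The three non-trivial single-qubit Pauli axes. -/
inductive PauliAxis
  | X | Y | Z
  deriving DecidableEq

instance : Fintype PauliAxis where
  elems := {.X, .Y, .Z}
  complete := fun a => by cases a <;> decide

/-- A Pauli string on `n` qubits, i.e. an element of `{I, X, Y, Z}^n`; `none` is the identity. -/
abbrev PauliString (n : ℕ) : Type := Fin n → Option PauliAxis

/-- Operators on `n` qubits, as matrices in the computational basis. -/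
abbrev QOp (n : ℕ) : Type := Matrix (Fin n → Fin 2) (Fin n → Fin 2) ℂ

/-- The Pauli matrices `X`, `Y`, `Z`. -/
def axisMatrix : PauliAxis → Matrix (Fin 2) (Fin 2) ℂ
  | .X => !![0, 1; 1, 0]
  | .Y => !![0, -Complex.I; Complex.I, 0]
  | .Z => !![1, 0; 0, -1]

/-- The matrices `I`, `X`, `Y`, `Z`. -/
def pauliMatrix : Option PauliAxis → Matrix (Fin 2) (Fin 2) ℂ
  | none => 1
  | some a => axisMatrix a

/-- The tensor product of single-qubit operators. -/
def tensorOp {n : ℕ} (V : Fin n → Matrix (Fin 2) (Fin 2) ℂ) : QOp n :=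
  Matrix.of fun x y => ∏ q, V q (x q) (y q)

/-- The operator of a Pauli string. -/
def pauliOp {n : ℕ} (P : PauliString n) : QOp n :=
  tensorOp fun q => pauliMatrix (P q)

/-- The Pauli weight: the number of qubits on which `P` acts non-trivially. -/
def weight {n : ℕ} (P : PauliString n) : ℕ :=
  (Finset.univ.filter fun q => P q ≠ none).card

/-- Clifford unitaries: conjugation maps every Pauli string to plus or minus a Pauli string. -/
def IsClifford {n : ℕ} (C : QOp n) : Prop :=
  C ∈ Matrix.unitaryGroup (Fin n → Fin 2) ℂ ∧
    ∀ P : PauliString n, ∃ Q : PauliString n,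
      Cᴴ * pauliOp P * C = pauliOp Q ∨ Cᴴ * pauliOp P * C = -pauliOp Q

/-- A Clifford unitary of one qubit. -/
def IsOneQubitClifford (V : Matrix (Fin 2) (Fin 2) ℂ) : Prop :=
  V ∈ Matrix.unitaryGroup (Fin 2) ℂ ∧
    ∀ a : PauliAxis, ∃ b : PauliAxis,
      Vᴴ * axisMatrix a * V = axisMatrix b ∨ Vᴴ * axisMatrix a * V = -axisMatrix b

/-- A layer of single-qubit Clifford gates (a gate on one qubit is the case in which all other
factors are the identity). -/
def IsSingleQubitCliffordLayer {n : ℕ} (C : QOp n) : Prop :=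
  ∃ V : Fin n → Matrix (Fin 2) (Fin 2) ℂ, (∀ q, IsOneQubitClifford (V q)) ∧ C = tensorOp V

/-- The data of a circuit `∏ᵢ Cᵢ Uᵢ(αᵢ)`, with Clifford unitaries `Cᵢ` and Pauli rotations
`Uᵢ(αᵢ) = exp(-i αᵢ Pᵢ / 2)`. -/
structure Circuit (n m : ℕ) where
  clifford : Fin m → QOp n
  isClifford : ∀ i, IsClifford (clifford i)
  generator : Fin m → PauliString n

/-- The Pauli rotation `exp(-i θ P / 2)`. -/
def rotation {n : ℕ} (P : PauliString n) (θ : ℝ) : QOp n :=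
  NormedSpace.exp ((-(Complex.I * (θ : ℂ) / 2)) • pauliOp P)

/-- The circuit unitary `C₁ U₁(α₁) C₂ U₂(α₂) ⋯ Cₘ Uₘ(αₘ)`. -/
def Circuit.unitary {n m : ℕ} (U : Circuit n m) (α : Fin m → ℝ) : QOp n :=
  (List.ofFn fun i => U.clifford i * rotation (U.generator i) (α i)).prod

/-- Density matrices. -/
def IsState {n : ℕ} (ρ : QOp n) : Prop := ρ.PosSemidef ∧ ρ.trace = 1

/-- The observable `∑_P a_P P`. -/
def observable {n : ℕ} (a : PauliString n → ℝ) : QOp n := ∑ P, (a P : ℂ) • pauliOp P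

/-- The number of Pauli strings with non-zero coefficient. -/
def numPaulis {n : ℕ} (a : PauliString n → ℝ) : ℕ :=
  (Finset.univ.filter fun P => a P ≠ 0).card

/-- The 1-norm of the coefficient vector. -/
def norm₁ {n : ℕ} (a : PauliString n → ℝ) : ℝ := ∑ P, |a P|

/-- The expectation function `f(α) = Tr[O U(α) ρ U(α)†]`. -/
def expectation {n m : ℕ} (U : Circuit n m) (a : PauliString n → ℝ) (ρ : QOp n)
    (α : Fin m → ℝ) : ℝ :=
  (observable a * U.unitary α * ρ * (U.unitary α)ᴴ).trace.re

/-! ### Pauli paths -/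

/-- The back-propagated Pauli operator (a Pauli string up to sign) along the frequency vector `ω`,
starting from `Q`, after the layers before the given position. In each layer, `M` is replaced by
`C† M C`, and then, if the sine branch is taken (`ω i = -1`), by `i [P, C† M C] / 2`. -/
def pathOp {n m : ℕ} (U : Circuit n m) (Q : PauliString n) (ω : Fin m → SignType)
    (j : Fin (m + 1)) : QOp n :=
  Fin.induction (motive := fun _ => QOp n) (pauliOp Q)
    (fun i M =>
      let M' := (U.clifford i)ᴴ * M * U.clifford i
      let P := pauliOp (U.generator i)
      if ω i = -1 then (Complex.I / 2) • (P * M' - M' * P) else M') j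

/-- `ω` is a Pauli path of `Q`: `ω i = 0` exactly where the operator that arrives at the `i`-th
rotation commutes with its generator (elsewhere `1` is the cosine and `-1` the sine branch). -/
def IsPath {n m : ℕ} (U : Circuit n m) (Q : PauliString n) (ω : Fin m → SignType) : Prop :=
  ∀ i : Fin m, ω i = 0 ↔
    Commute (pauliOp (U.generator i))
      ((U.clifford i)ᴴ * pathOp U Q ω i.castSucc * U.clifford i)

/-- The number of sine factors along a path. -/
def numSines {m : ℕ} (ω : Fin m → SignType) : ℕ := (Finset.univ.filter fun i => ω i = -1).card

/-- The factor picked up at one rotation. -/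
def pathFactor (s : SignType) (θ : ℝ) : ℝ :=
  if s = 0 then 1 else if s = 1 then Real.cos θ else Real.sin θ

/-- The coefficient `Φ_ω(α)` of a path. -/
def pathCoeff {m : ℕ} (ω : Fin m → SignType) (α : Fin m → ℝ) : ℝ :=
  ∏ i, pathFactor (ω i) (α i)

open Classical in
/-- The paths of `Q` with at most `κ` sines. -/
def retainedPaths {n m : ℕ} (U : Circuit n m) (κ : ℕ) (Q : PauliString n) :
    Finset (Fin m → SignType) :=
  Finset.univ.filter fun ω => IsPath U Q ω ∧ numSines ω ≤ κ

/-- The truncated back-propagated observable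
`Õ(α) = ∑_Q a_Q ∑_{ω path of Q, at most κ sines} Φ_ω(α) Q_ω`. -/
def truncatedObservable {n m : ℕ} (U : Circuit n m) (κ : ℕ) (a : PauliString n → ℝ)
    (α : Fin m → ℝ) : QOp n :=
  ∑ Q, (a Q : ℂ) • ∑ ω ∈ retainedPaths U κ Q, (pathCoeff ω α : ℂ) • pathOp U Q ω (Fin.last m)

/-- The coefficient `c_P(α)` of the Pauli string `P` in the truncated back-propagated observable,
`Tr[P Õ(α)] / 2^n`. -/
def truncatedCoeff {n m : ℕ} (U : Circuit n m) (κ : ℕ) (a : PauliString n → ℝ)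
    (α : Fin m → ℝ) (P : PauliString n) : ℝ :=
  (pauliOp P * truncatedObservable U κ a α).trace.re / 2 ^ n

/-- The cost of the truncated propagation of all Pauli terms of the observable, in units of the
time needed to propagate one Pauli string through one layer: each retained path goes through `m`
layers. -/
def propagationCost {n m : ℕ} (U : Circuit n m) (κ : ℕ) (a : PauliString n → ℝ) : ℕ :=
  ∑ Q ∈ Finset.univ.filter (fun Q => a Q ≠ 0), m * (retainedPaths U κ Q).card

/-! ### Parameters in a hypercube -/

/-- The hypercube `[-r, r]^m`. -/
def cube (m : ℕ) (r : ℝ) : Set (Fin m → ℝ) := Set.Icc (fun _ => -r) (fun _ => r)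

/-- The uniform distribution on the hypercube `[-r, r]^m`. -/
def uniformCube (m : ℕ) (r : ℝ) : MeasureTheory.Measure (Fin m → ℝ) :=
  ProbabilityTheory.cond MeasureTheory.volume (cube m r)

/-- A truncation order that is sufficient for the mean square error `ε`. -/
def SufficientOrder {n : ℕ} (m : ℕ) (r : ℝ) (a : PauliString n → ℝ) (κ : ℕ) (ε : ℝ) : Prop :=
  1 ≤ κ ∧ (m : ℝ) * r ^ 2 ≤ 3 * κ ∧
    4 * norm₁ a ^ 2 * (Real.exp 1 * m * r ^ 2 / (3 * κ)) ^ κ ≤ ε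

/-! ### Randomized Pauli measurements -/

/-- The record of one randomized Pauli measurement: the measured axis of every qubit and the
outcome bit of every qubit (bit `0` is the eigenvalue `1`, bit `1` the eigenvalue `-1`). -/
abbrev Shot (n : ℕ) : Type := (Fin n → PauliAxis) × (Fin n → Fin 2)

/-- The projector onto the outcome of a shot. -/
def shotProjector {n : ℕ} (x : Shot n) : QOp n :=
  tensorOp fun q => (1 / 2 : ℂ) • (1 + (-1 : ℂ) ^ (x.2 q : ℕ) • axisMatrix (x.1 q))

/-- The probability of a shot on the state `ρ`: the axes are independent and uniform, and the
outcome bits follow the Born rule. -/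
def shotProb {n : ℕ} (ρ : QOp n) (x : Shot n) : ℝ :=
  (1 / 3) ^ n * (shotProjector x * ρ).trace.re

open Classical in
/-- The probability of an event about `N` independent shots on copies of `ρ`. -/
def shotsProb {n : ℕ} (ρ : QOp n) (N : ℕ) (E : Set (Fin N → Shot n)) : ℝ :=
  ∑ d ∈ Finset.univ.filter (fun d => d ∈ E), ∏ t, shotProb ρ (d t)

/-- `N` randomized Pauli measurements suffice to surrogate the landscape by truncated Pauli
propagation at order `κ`: there are estimates `ô_P` of `Tr[P ρ]`, functions of the measurement
record alone, such that for every state `ρ`, with probability at least `1 - δ`, the surrogate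
`∑_P c_P(α) ô_P` has mean square error at most `ε` over the hypercube. -/
def ShotsSuffice {n m : ℕ} (U : Circuit n m) (a : PauliString n → ℝ) (r : ℝ) (κ : ℕ)
    (ε δ : ℝ) (N : ℕ) : Prop :=
  ∃ o : (Fin N → Shot n) → PauliString n → ℝ, ∀ ρ : QOp n, IsState ρ →
    1 - δ ≤ shotsProb ρ N
      {d | ∫ α, ((∑ P, truncatedCoeff U κ a α P * o d P) - expectation U a ρ α) ^ 2
            ∂(uniformCube m r) ≤ ε}

end

end ShadowSurrogation

/-!
The error of the surrogate is a trigonometric polynomial in the angles, a sum over Pauli paths: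
`∑_Q a_Q ∑_ω Φ_ω(α) x_{Q,ω}`, where `x_{Q,ω}` is the error of the estimate of the Pauli string
`Q_ω` if the path `ω` is retained, and minus its exact expectation value otherwise
(`surrogate_sub_expectation_eq`, which rests on the path expansion `unitary_conj_pauliOp`). Over a
symmetric cube the coefficients `Φ_ω` of the paths of one `Q` are orthogonal: where two paths first
differ, one has a cosine and the other a sine. Their second moments `W_ω = E[Φ_ω²]`
(`pathWeight`) add up to `1`, so that they are the probabilities of a random walk down the tree of
branchings, in which a sine branch has probability at most `r² / 3`. With the Cauchy–Schwarz
inequality across the terms of the observable, the mean square error is at most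
`‖a‖₁ ∑_Q |a_Q| ∑_ω W_ω x_{Q,ω}²` (`integral_sum_sum_paths_sq_le`).

*Truncation.* The discarded paths contribute at most `‖a‖₁²` times the probability of more than
`κ` sines, which a Chernoff bound controls (`sum_pathWeight_tail_le`); sufficiency of `κ` makes
this at most `ε / 4`.

*Sampling.* The estimate of `P` is the mean of its single-shot classical-shadow estimators. These
are unbiased and bounded by `3 ^ weight P`, so the mean is sub-Gaussian by Hoeffding's lemma. No
union bound over Pauli strings is needed: the retained paths contribute a weighted sum of squares
of sub-Gaussian variables, and Jensen's inequality for `y ↦ cosh √y` shows that its tail is that of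
one sub-Gaussian variable whose variance proxy is the weighted average of theirs
(`sum_filter_lt_weighted_sq_le`). Hence a constant multiple of `log (1 / δ) / ε` measurements is
enough, and the factor `min (log n) (log (m N))` enters only through being at least `log 2`. For
weights at most `k` the average variance proxy is at most of order `9 ^ k`. For single-qubit
Cliffords a path with `j` sines has weight at most `w + j l`, and the average of `9 ^ (w + j l)` is
bounded uniformly in `κ`, because the number of sines has bounded exponential moments
(`sum_pathWeight_mul_pow_le`).

*Cost.* The number of paths with at most `κ` sines is bounded by the generating function
`∑_ω x ^ #sin(ω) ≤ (1 + x) ^ m` at `x = κ / m`. The truncation error `(const / κ) ^ κ` decays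
super-exponentially in `κ`, so for small `ε` an order `κ ≤ log (1 / ε) - 1` is sufficient.
-/

namespace ShadowSurrogation

open scoped Matrix ComplexOrder
open Finset MeasureTheory

variable {n m : ℕ}

/-! ### Tensor products of single-qubit operators -/

theorem tensorOp_mul (V W : Fin n → Matrix (Fin 2) (Fin 2) ℂ) :
    tensorOp V * tensorOp W = tensorOp fun q => V q * W q := by
  ext x y
  simp only [tensorOp, Matrix.mul_apply, Matrix.of_apply, ← Finset.prod_mul_distrib]
  rw [Fintype.prod_sum]

theorem tensorOp_smul (c : Fin n → ℂ) (V : Fin n → Matrix (Fin 2) (Fin 2) ℂ) :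
    tensorOp (fun q => c q • V q) = (∏ q, c q) • tensorOp V := by
  ext x y
  simp [tensorOp, Finset.prod_mul_distrib]

theorem tensorOp_one : tensorOp (fun _ : Fin n => 1) = 1 := by
  ext x y
  by_cases h : x = y
  · subst h; simp [tensorOp]
  · obtain ⟨q, hq⟩ := Function.ne_iff.1 h
    rw [Matrix.one_apply_ne h]
    exact Finset.prod_eq_zero (Finset.mem_univ q) (Matrix.one_apply_ne hq)

theorem tensorOp_conjTranspose (V : Fin n → Matrix (Fin 2) (Fin 2) ℂ) :
    (tensorOp V)ᴴ = tensorOp fun q => (V q)ᴴ := by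
  ext x y
  simp [tensorOp, Matrix.conjTranspose_apply]

theorem trace_tensorOp (V : Fin n → Matrix (Fin 2) (Fin 2) ℂ) :
    (tensorOp V).trace = ∏ q, (V q).trace := by
  simp only [tensorOp, Matrix.trace, Matrix.diag, Matrix.of_apply]
  rw [Fintype.prod_sum]

/-- Tensor products are multilinear: a sum over independent local choices is the tensor product of
the local sums. -/
theorem sum_tensorOp {ι : Type*} [Fintype ι] (M : Fin n → ι → Matrix (Fin 2) (Fin 2) ℂ) :
    ∑ x : Fin n → ι, tensorOp (fun q => M q (x q)) = tensorOp fun q => ∑ i, M q i := by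
  ext a b
  simp only [tensorOp, Matrix.sum_apply, Matrix.of_apply]
  rw [Fintype.prod_sum]

/-! ### The Pauli group -/

theorem axisMatrix_conjTranspose (a : PauliAxis) : (axisMatrix a)ᴴ = axisMatrix a := by
  ext i j
  cases a <;> fin_cases i <;> fin_cases j <;> simp [axisMatrix]

theorem axisMatrix_mul_self (a : PauliAxis) : axisMatrix a * axisMatrix a = 1 := by
  ext i j
  cases a <;> fin_cases i <;> fin_cases j <;> simp [axisMatrix]

theorem pauliMatrix_conjTranspose (p : Option PauliAxis) : (pauliMatrix p)ᴴ = pauliMatrix p := by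
  cases p <;> simp [pauliMatrix, axisMatrix_conjTranspose]

theorem pauliMatrix_mul_self (p : Option PauliAxis) : pauliMatrix p * pauliMatrix p = 1 := by
  cases p <;> simp [pauliMatrix, axisMatrix_mul_self]

theorem exists_axisMatrix_mul (a b : PauliAxis) : ∃ (c : ℂ) (r : Option PauliAxis),
    axisMatrix a * axisMatrix b = c • pauliMatrix r := by
  have key : ∀ (c : ℂ) (r : Option PauliAxis),
      (∀ i j, (axisMatrix a * axisMatrix b) i j = (c • pauliMatrix r) i j) →
      ∃ (c : ℂ) (r : Option PauliAxis), axisMatrix a * axisMatrix b = c • pauliMatrix r :=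
    fun c r h => ⟨c, r, Matrix.ext h⟩
  by_cases hab : a = b
  · subst hab
    exact ⟨1, none, by simp [axisMatrix_mul_self, pauliMatrix]⟩
  cases a <;> cases b <;> first
    | exact absurd rfl hab
    | (refine key Complex.I (some .X) fun i j => ?_
       fin_cases i <;> fin_cases j <;> simp [axisMatrix, pauliMatrix] <;> done)
    | (refine key (-Complex.I) (some .X) fun i j => ?_
       fin_cases i <;> fin_cases j <;> simp [axisMatrix, pauliMatrix] <;> done)
    | (refine key Complex.I (some .Y) fun i j => ?_
       fin_cases i <;> fin_cases j <;> simp [axisMatrix, pauliMatrix] <;> done)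
    | (refine key (-Complex.I) (some .Y) fun i j => ?_
       fin_cases i <;> fin_cases j <;> simp [axisMatrix, pauliMatrix] <;> done)
    | (refine key Complex.I (some .Z) fun i j => ?_
       fin_cases i <;> fin_cases j <;> simp [axisMatrix, pauliMatrix] <;> done)
    | (refine key (-Complex.I) (some .Z) fun i j => ?_
       fin_cases i <;> fin_cases j <;> simp [axisMatrix, pauliMatrix])

theorem exists_pauliMatrix_mul (p q : Option PauliAxis) : ∃ (c : ℂ) (r : Option PauliAxis),
    pauliMatrix p * pauliMatrix q = c • pauliMatrix r ∧
      (p = none → q = none → r = none) := by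
  rcases p with _ | a
  · exact ⟨1, q, by simp [pauliMatrix], fun _ h => h⟩
  rcases q with _ | b
  · exact ⟨1, some a, by simp [pauliMatrix], fun h => absurd h (by simp)⟩
  · obtain ⟨c, r, h⟩ := exists_axisMatrix_mul a b
    exact ⟨c, r, h, fun h => by simp at h⟩

theorem pauliMatrix_comm_or_anticomm (p q : Option PauliAxis) : ∃ s : ℂ, (s = 1 ∨ s = -1) ∧
    pauliMatrix p * pauliMatrix q = s • (pauliMatrix q * pauliMatrix p) := by
  rcases p with _ | a
  · exact ⟨1, .inl rfl, by simp [pauliMatrix]⟩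
  rcases q with _ | b
  · exact ⟨1, .inl rfl, by simp [pauliMatrix]⟩
  by_cases hab : a = b
  · subst hab
    exact ⟨1, .inl rfl, by simp⟩
  · refine ⟨-1, .inr rfl, ?_⟩
    ext i j
    cases a <;> cases b <;> first
      | exact absurd rfl hab
      | (fin_cases i <;> fin_cases j <;> simp [axisMatrix, pauliMatrix])

theorem trace_axisMatrix (a : PauliAxis) : (axisMatrix a).trace = 0 := by
  cases a <;> simp [axisMatrix, Matrix.trace_fin_two]

theorem trace_pauliMatrix_mul (p q : Option PauliAxis) :
    (pauliMatrix p * pauliMatrix q).trace = if p = q then 2 else 0 := by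
  split_ifs with h
  · subst h
    rw [pauliMatrix_mul_self]; simp
  · rcases p with _ | a <;> rcases q with _ | b
    · exact absurd rfl h
    · simp [pauliMatrix, trace_axisMatrix]
    · simp [pauliMatrix, trace_axisMatrix]
    · cases a <;> cases b <;> first
        | exact absurd rfl h
        | simp [axisMatrix, pauliMatrix, Matrix.trace_fin_two]

theorem pauliOp_conjTranspose (P : PauliString n) : (pauliOp P)ᴴ = pauliOp P := by
  simp [pauliOp, tensorOp_conjTranspose, pauliMatrix_conjTranspose]

theorem pauliOp_mul_self (P : PauliString n) : pauliOp P * pauliOp P = 1 := by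
  simp [pauliOp, tensorOp_mul, pauliMatrix_mul_self, tensorOp_one]

theorem trace_pauliOp_mul (P Q : PauliString n) :
    (pauliOp P * pauliOp Q).trace = if P = Q then 2 ^ n else 0 := by
  rw [pauliOp, pauliOp, tensorOp_mul, trace_tensorOp]
  simp only [trace_pauliMatrix_mul]
  split_ifs with h
  · subst h; simp
  · obtain ⟨q, hq⟩ := Function.ne_iff.1 h
    exact Finset.prod_eq_zero (Finset.mem_univ q) (if_neg hq)

theorem weight_le_add {P Q R : PauliString n} (h : ∀ q, P q = none → Q q = none → R q = none) :
    weight R ≤ weight P + weight Q := by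
  refine le_trans (Finset.card_le_card ?_) (Finset.card_union_le _ _)
  intro q hq
  simp only [Finset.mem_union, Finset.mem_filter, Finset.mem_univ, true_and] at hq ⊢
  by_contra hcon
  push Not at hcon
  exact hq (h q hcon.1 hcon.2)

theorem exists_pauliOp_mul (P Q : PauliString n) : ∃ (c : ℂ) (R : PauliString n),
    pauliOp P * pauliOp Q = c • pauliOp R ∧ weight R ≤ weight P + weight Q := by
  choose c R h hw using fun q => exists_pauliMatrix_mul (P q) (Q q)
  refine ⟨∏ q, c q, R, ?_, weight_le_add hw⟩
  rw [pauliOp, pauliOp, tensorOp_mul, pauliOp, ← tensorOp_smul]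
  exact congrArg tensorOp (funext h)

theorem pauliOp_comm_or_anticomm (P Q : PauliString n) :
    pauliOp P * pauliOp Q = pauliOp Q * pauliOp P ∨
      pauliOp P * pauliOp Q = -(pauliOp Q * pauliOp P) := by
  choose s hs h using fun q => pauliMatrix_comm_or_anticomm (P q) (Q q)
  have key : pauliOp P * pauliOp Q = (∏ q, s q) • (pauliOp Q * pauliOp P) := by
    rw [pauliOp, pauliOp, tensorOp_mul, tensorOp_mul, ← tensorOp_smul]
    exact congrArg tensorOp (funext h)
  have hprod : (∏ q, s q) = 1 ∨ (∏ q, s q) = -1 := by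
    refine Finset.prod_induction s (fun z => z = 1 ∨ z = -1) ?_ (.inl rfl) fun q _ => hs q
    rintro a b (rfl | rfl) (rfl | rfl) <;> simp
  rcases hprod with h1 | h1 <;> rw [key, h1] <;> simp

/-- Pauli strings up to sign, the operators that occur along a Pauli path. -/
def IsSignedPauli (M : QOp n) (R : PauliString n) : Prop := M = pauliOp R ∨ M = -pauliOp R

theorem IsSignedPauli.neg {M : QOp n} {R : PauliString n} (h : IsSignedPauli M R) :
    IsSignedPauli (-M) R := by
  rcases h with rfl | rfl
  · exact .inr rfl
  · exact .inl (neg_neg _)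

theorem IsSignedPauli.comm_or_anticomm {M : QOp n} {R : PauliString n} (h : IsSignedPauli M R)
    (P : PauliString n) : pauliOp P * M = M * pauliOp P ∨ pauliOp P * M = -(M * pauliOp P) := by
  rcases h with rfl | rfl <;> rcases pauliOp_comm_or_anticomm P R with h | h <;> simp [h]

/-- If a Pauli string `P` anticommutes with a signed Pauli string `M`, then `i P M` is a signed
Pauli string. -/
theorem IsSignedPauli.exists_I_smul_mul {M : QOp n} {R : PauliString n} (h : IsSignedPauli M R)
    {P : PauliString n} (hP : pauliOp P * M = -(M * pauliOp P)) :
    ∃ R', IsSignedPauli (Complex.I • (pauliOp P * M)) R' ∧ weight R' ≤ weight P + weight R := by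
  have hP' : pauliOp P * pauliOp R = -(pauliOp R * pauliOp P) := by
    rcases h with rfl | rfl
    · exact hP
    · simpa using congrArg Neg.neg hP
  obtain ⟨c, R', hR', hw⟩ := exists_pauliOp_mul P R
  refine ⟨R', ?_, hw⟩
  -- The phase squares to `-1`, because `(P R)² = -P² R² = -1`.
  have hsq : (pauliOp P * pauliOp R) * (pauliOp P * pauliOp R) = -1 := by
    calc (pauliOp P * pauliOp R) * (pauliOp P * pauliOp R)
        = (pauliOp P * pauliOp R) * -(pauliOp R * pauliOp P) := by rw [← hP']
      _ = -(pauliOp P * (pauliOp R * pauliOp R) * pauliOp P) := by noncomm_ring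
      _ = -1 := by rw [pauliOp_mul_self, mul_one, pauliOp_mul_self]
  rw [hR', smul_mul_smul_comm, pauliOp_mul_self] at hsq
  have hcc : c * c = -1 := by
    have := congrFun (congrFun hsq 0) 0
    simpa using this
  have hcases : Complex.I * c = 1 ∨ Complex.I * c = -1 := by
    have : (Complex.I * c - 1) * (Complex.I * c + 1) = 0 := by
      linear_combination Complex.I ^ 2 * hcc - Complex.I_sq
    rcases mul_eq_zero.1 this with h | h
    · exact .inl (sub_eq_zero.1 h)
    · exact .inr (eq_neg_of_add_eq_zero_left h)
  have hsigned : IsSignedPauli (Complex.I • (pauliOp P * pauliOp R)) R' := by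
    rw [hR', smul_smul]
    rcases hcases with h | h <;> rw [h]
    · exact .inl (one_smul _ _)
    · exact .inr (by simp)
  rcases h with rfl | rfl
  · exact hsigned
  · simpa using hsigned.neg

/-! ### Pauli rotations -/

/-- The exponential of a multiple of an involution, from its two spectral projections. -/
theorem exp_smul_of_mul_self {ι : Type*} [Fintype ι] [DecidableEq ι] {P : Matrix ι ι ℂ}
    (hP : P * P = 1) (z : ℂ) :
    NormedSpace.exp (z • P) = Complex.cosh z • 1 + Complex.sinh z • P := by
  have hpow : ∀ k : ℕ, P ^ k = (1 / 2 : ℂ) • (1 + P) + ((-1) ^ k * (1 / 2) : ℂ) • (1 - P) := by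
    intro k
    induction k with
    | zero => simp only [pow_zero]; module
    | succ k ih =>
      rw [pow_succ, ih, add_mul, smul_mul_assoc, smul_mul_assoc, add_mul, sub_mul, hP, one_mul,
        pow_succ]
      module
  have hexp : ∀ w : ℂ, HasSum (fun k : ℕ => (k.factorial : ℂ)⁻¹ * w ^ k) (Complex.exp w) := by
    intro w
    have := NormedSpace.exp_series_hasSum_exp' (𝕂 := ℂ) w
    rw [← Complex.exp_eq_exp_ℂ] at this
    simpa using this
  have hterm : ∀ k : ℕ, ((k.factorial : ℂ)⁻¹) • (z • P) ^ k =
      ((k.factorial : ℂ)⁻¹ * z ^ k) • ((1 / 2 : ℂ) • (1 + P)) +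
        ((k.factorial : ℂ)⁻¹ * (-z) ^ k) • ((1 / 2 : ℂ) • (1 - P)) := by
    intro k
    rw [smul_pow, hpow, neg_pow z]
    module
  have hsum : HasSum (fun k : ℕ => ((k.factorial : ℂ)⁻¹) • (z • P) ^ k)
      (Complex.exp z • ((1 / 2 : ℂ) • (1 + P)) + Complex.exp (-z) • ((1 / 2 : ℂ) • (1 - P))) := by
    simp only [hterm]
    exact ((hexp z).smul_const _).add ((hexp (-z)).smul_const _)
  rw [NormedSpace.exp_eq_tsum ℂ]
  simp only
  rw [hsum.tsum_eq, Complex.cosh, Complex.sinh]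
  module

theorem rotation_eq (P : PauliString n) (θ : ℝ) :
    rotation P θ = (Real.cos (θ / 2) : ℂ) • 1 - (Complex.I * Real.sin (θ / 2)) • pauliOp P := by
  have harg : -(Complex.I * (θ : ℂ) / 2) = -(((θ / 2 : ℝ) : ℂ) * Complex.I) := by
    push_cast; ring
  rw [rotation, exp_smul_of_mul_self (pauliOp_mul_self P), harg, Complex.cosh_neg,
    Complex.sinh_neg, Complex.cosh_mul_I, Complex.sinh_mul_I, Complex.ofReal_cos,
    Complex.ofReal_sin, sub_eq_add_neg, ← neg_smul, mul_comm Complex.I]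

theorem rotation_conjTranspose (P : PauliString n) (θ : ℝ) :
    (rotation P θ)ᴴ =
      (Real.cos (θ / 2) : ℂ) • 1 + (Complex.I * Real.sin (θ / 2)) • pauliOp P := by
  rw [rotation_eq, Matrix.conjTranspose_sub, Matrix.conjTranspose_smul, Matrix.conjTranspose_smul,
    Matrix.conjTranspose_one, pauliOp_conjTranspose, sub_eq_add_neg, ← neg_smul]
  simp [-Complex.ofReal_cos, -Complex.ofReal_sin]

theorem rotation_conj_of_commute {P : PauliString n} {M : QOp n} (θ : ℝ)
    (h : Commute (pauliOp P) M) : (rotation P θ)ᴴ * M * rotation P θ = M := by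
  have h2 : pauliOp P * M * pauliOp P = M := by
    rw [h.eq, mul_assoc, pauliOp_mul_self, mul_one]
  have hcs : (Real.cos (θ / 2) : ℂ) * Real.cos (θ / 2) +
      Real.sin (θ / 2) * Real.sin (θ / 2) = 1 := by
    rw [← sq, ← sq]; exact_mod_cast Real.cos_sq_add_sin_sq (θ / 2)
  rw [rotation_conjTranspose, rotation_eq]
  generalize (Real.cos (θ / 2) : ℂ) = c at *
  generalize (Real.sin (θ / 2) : ℂ) = s at *
  have : (c • (1 : QOp n) + (Complex.I * s) • pauliOp P) * M *
      (c • 1 - (Complex.I * s) • pauliOp P) =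
      (c * c) • M + (c * (Complex.I * s)) • (pauliOp P * M - M * pauliOp P) -
        ((Complex.I * s) * (Complex.I * s)) • (pauliOp P * M * pauliOp P) := by
    simp only [add_mul, mul_sub, smul_mul_assoc, mul_smul_comm, one_mul, mul_one]
    module
  rw [this, h2, h.eq, sub_self, smul_zero, add_zero, ← sub_smul]
  have : c * c - (Complex.I * s) * (Complex.I * s) = 1 := by
    linear_combination hcs - s * s * Complex.I_mul_I
  rw [this, one_smul]

theorem rotation_conj_of_anticommute {P : PauliString n} {M : QOp n} (θ : ℝ)
    (h : pauliOp P * M = -(M * pauliOp P)) :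
    (rotation P θ)ᴴ * M * rotation P θ = (Real.cos θ : ℂ) • M +
      (Real.sin θ : ℂ) • ((Complex.I / 2) • (pauliOp P * M - M * pauliOp P)) := by
  have h2 : pauliOp P * M * pauliOp P = -M := by
    rw [h, neg_mul, mul_assoc, pauliOp_mul_self, mul_one]
  have hcos : (Real.cos θ : ℂ) =
      Real.cos (θ / 2) * Real.cos (θ / 2) - Real.sin (θ / 2) * Real.sin (θ / 2) := by
    rw [← sq, ← sq]
    exact_mod_cast (by rw [← Real.cos_two_mul']; ring_nf)
  have hsin : (Real.sin θ : ℂ) = 2 * Real.sin (θ / 2) * Real.cos (θ / 2) := by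
    exact_mod_cast (by rw [← Real.sin_two_mul]; ring_nf)
  rw [rotation_conjTranspose, rotation_eq, hcos, hsin]
  generalize (Real.cos (θ / 2) : ℂ) = c at *
  generalize (Real.sin (θ / 2) : ℂ) = s at *
  have : (c • (1 : QOp n) + (Complex.I * s) • pauliOp P) * M *
      (c • 1 - (Complex.I * s) • pauliOp P) =
      (c * c) • M + (c * (Complex.I * s)) • (pauliOp P * M - M * pauliOp P) -
        ((Complex.I * s) * (Complex.I * s)) • (pauliOp P * M * pauliOp P) := by
    simp only [add_mul, mul_sub, smul_mul_assoc, mul_smul_comm, one_mul, mul_one]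
    module
  rw [this, h2]
  have hII : (Complex.I * s) * (Complex.I * s) = - (s * s) := by
    linear_combination s * s * Complex.I_mul_I
  rw [hII]
  module

/-! ### Expectation values of Pauli strings -/

theorem trace_mul_nonneg {A ρ : QOp n} (hA : A.IsHermitian) (hA2 : A * A = A)
    (hρ : ρ.PosSemidef) : 0 ≤ (A * ρ).trace.re := by
  have h : (A * ρ).trace = (A * ρ * Aᴴ).trace := by
    rw [Matrix.trace_mul_comm (A * ρ), hA.eq, ← mul_assoc, hA2]
  rw [h]
  exact (Complex.nonneg_iff.1 (hρ.mul_mul_conjTranspose_same A).trace_nonneg).1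

theorem abs_trace_pauliOp_mul_le_one {ρ : QOp n} (hρ : IsState ρ) (P : PauliString n) :
    |(pauliOp P * ρ).trace.re| ≤ 1 := by
  have key : ∀ M : QOp n, M.IsHermitian → M * M = 1 → -1 ≤ (M * ρ).trace.re := by
    intro M hM hM2
    have hA : ((1 / 2 : ℝ) • (1 + M) : QOp n).IsHermitian := by
      rw [Matrix.IsHermitian, Matrix.conjTranspose_smul, Matrix.conjTranspose_add,
        Matrix.conjTranspose_one, hM.eq]
      simp
    have h := trace_mul_nonneg hA (by
      rw [smul_mul_smul_comm, add_mul, mul_add, mul_add, hM2, one_mul, mul_one, one_mul]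
      module) hρ.1
    rw [smul_mul_assoc, Matrix.trace_smul, add_mul, Matrix.trace_add, one_mul, hρ.2] at h
    simp at h
    linarith
  have h1 := key _ (pauliOp_conjTranspose P) (pauliOp_mul_self P)
  have h2 := key (-pauliOp P) (by
    rw [Matrix.IsHermitian, Matrix.conjTranspose_neg, pauliOp_conjTranspose])
    (by rw [neg_mul_neg, pauliOp_mul_self])
  rw [neg_mul, Matrix.trace_neg, Complex.neg_re] at h2
  exact abs_le.2 ⟨h1, by linarith⟩

theorem IsSignedPauli.abs_trace_le_one {M : QOp n} {R : PauliString n} (h : IsSignedPauli M R)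
    {ρ : QOp n} (hρ : IsState ρ) : |(M * ρ).trace.re| ≤ 1 := by
  rcases h with rfl | rfl
  · exact abs_trace_pauliOp_mul_le_one hρ R
  · simpa using abs_trace_pauliOp_mul_le_one hρ R

theorem IsSignedPauli.exists_sum_coeff_eq {M : QOp n} {R : PauliString n}
    (h : IsSignedPauli M R) : ∃ s : ℝ, (s = 1 ∨ s = -1) ∧ M = (s : ℂ) • pauliOp R ∧
      ∀ P, (pauliOp P * M).trace.re / 2 ^ n = if P = R then s else 0 := by
  have key : ∀ P : PauliString n, (pauliOp P * pauliOp R).trace.re / 2 ^ n =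
      if P = R then 1 else 0 := by
    intro P
    rw [trace_pauliOp_mul]
    split_ifs
    · have : ((2 : ℂ) ^ n).re = 2 ^ n := by exact_mod_cast Complex.ofReal_re (2 ^ n)
      rw [this, div_self (by positivity)]
    · simp
  rcases h with rfl | rfl
  · exact ⟨1, .inl rfl, by simp, key⟩
  · refine ⟨-1, .inr rfl, by simp, fun P => ?_⟩
    rw [mul_neg, Matrix.trace_neg, Complex.neg_re, neg_div, key]
    split_ifs <;> simp

/-! ### Pauli paths of a circuit -/

/-- The operator that arrives at the `i`-th rotation along a path. -/
noncomputable def arrivingOp (U : Circuit n m) (Q : PauliString n) (ω : Fin m → SignType)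
    (i : Fin m) : QOp n :=
  (U.clifford i)ᴴ * pathOp U Q ω i.castSucc * U.clifford i

theorem pathOp_succ (U : Circuit n m) (Q : PauliString n) (ω : Fin m → SignType) (i : Fin m) :
    pathOp U Q ω i.succ = if ω i = -1 then
      (Complex.I / 2) • (pauliOp (U.generator i) * arrivingOp U Q ω i -
        arrivingOp U Q ω i * pauliOp (U.generator i)) else arrivingOp U Q ω i := rfl

theorem pathOp_congr (U : Circuit n m) (Q : PauliString n) {ω ω' : Fin m → SignType} (i : Fin m)
    (h : ∀ j < i, ω j = ω' j) : pathOp U Q ω i.castSucc = pathOp U Q ω' i.castSucc := by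
  have key : ∀ k : Fin (m + 1), k ≤ i.castSucc → pathOp U Q ω k = pathOp U Q ω' k := by
    intro k
    induction k using Fin.induction with
    | zero => exact fun _ => rfl
    | succ k ih =>
      intro hk
      have hki : k < i := Fin.succ_le_castSucc_iff.1 hk
      rw [pathOp_succ, pathOp_succ, arrivingOp, arrivingOp, h k hki,
        ih (Fin.castSucc_le_castSucc_iff.2 hki.le)]
  exact key _ le_rfl

theorem isPath_iff {U : Circuit n m} {Q : PauliString n} {ω : Fin m → SignType} :
    IsPath U Q ω ↔
      ∀ i, ω i = 0 ↔ Commute (pauliOp (U.generator i)) (arrivingOp U Q ω i) := Iff.rfl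

theorem IsSignedPauli.clifford_conj {C M : QOp n} {R : PauliString n} (hC : IsClifford C)
    (h : IsSignedPauli M R) : ∃ R', IsSignedPauli (Cᴴ * M * C) R' := by
  obtain ⟨R', hR'⟩ := hC.2 R
  refine ⟨R', ?_⟩
  rcases h with rfl | rfl
  · exact hR'
  · rw [mul_neg, neg_mul]
    exact IsSignedPauli.neg hR'

theorem half_commutator_eq {P M : QOp n} (h : P * M = -(M * P)) :
    (Complex.I / 2) • (P * M - M * P) = Complex.I • (P * M) := by
  rw [← neg_eq_iff_eq_neg.2 h]
  module

/-- Sine branches are taken only where the arriving operator anticommutes with the generator, so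
every operator along a path is a Pauli string up to sign. -/
theorem IsPath.exists_isSignedPauli {U : Circuit n m} {Q : PauliString n} {ω : Fin m → SignType}
    (h : IsPath U Q ω) (j : Fin (m + 1)) : ∃ R, IsSignedPauli (pathOp U Q ω j) R := by
  induction j using Fin.induction with
  | zero => exact ⟨Q, .inl rfl⟩
  | succ i ih =>
    obtain ⟨R, hR⟩ := ih
    obtain ⟨R', hR'⟩ : ∃ R', IsSignedPauli (arrivingOp U Q ω i) R' :=
      hR.clifford_conj (U.isClifford i)
    rw [pathOp_succ]
    split_ifs with hi
    · rcases hR'.comm_or_anticomm (U.generator i) with hc | hc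
      · exact absurd ((h i).2 hc) (by rw [hi]; decide)
      · rw [half_commutator_eq hc]
        exact (hR'.exists_I_smul_mul hc).imp fun _ h => h.1
    · exact ⟨R', hR'⟩

theorem IsSignedPauli.unique {M : QOp n} {R R' : PauliString n} (h : IsSignedPauli M R)
    (h' : IsSignedPauli M R') : R = R' := by
  obtain ⟨s, hs, -, h1⟩ := h.exists_sum_coeff_eq
  obtain ⟨s', hs', -, h2⟩ := h'.exists_sum_coeff_eq
  by_contra hne
  have := (h1 R).symm.trans (h2 R)
  rw [if_pos rfl, if_neg hne] at this
  rcases hs with rfl | rfl <;> simp at this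

open Classical in
/-- All Pauli paths of `Q`. -/
noncomputable def paths (U : Circuit n m) (Q : PauliString n) : Finset (Fin m → SignType) :=
  Finset.univ.filter (IsPath U Q)

theorem mem_paths {U : Circuit n m} {Q : PauliString n} {ω : Fin m → SignType} :
    ω ∈ paths U Q ↔ IsPath U Q ω := by simp [paths]

theorem retainedPaths_eq (U : Circuit n m) (κ : ℕ) (Q : PauliString n) :
    retainedPaths U κ Q = (paths U Q).filter fun ω => numSines ω ≤ κ := by
  ext ω
  simp [retainedPaths, mem_paths]

theorem paths_zero (U : Circuit n 0) (Q : PauliString n) : paths U Q = Finset.univ :=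
  Finset.eq_univ_iff_forall.2 fun _ => mem_paths.2 fun i => i.elim0

/-- The circuit without its last layer. -/
def Circuit.init (U : Circuit n (m + 1)) : Circuit n m where
  clifford i := U.clifford i.castSucc
  isClifford i := U.isClifford i.castSucc
  generator i := U.generator i.castSucc

theorem pathOp_snoc (U : Circuit n (m + 1)) (Q : PauliString n) (ω : Fin m → SignType)
    (s : SignType) (i : Fin (m + 1)) :
    pathOp U Q (Fin.snoc ω s : Fin (m + 1) → SignType) i.castSucc = pathOp U.init Q ω i := by
  induction i using Fin.induction with
  | zero => rfl
  | succ i ih =>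
    have h1 : arrivingOp U Q (Fin.snoc ω s : Fin (m + 1) → SignType) i.castSucc =
        arrivingOp U.init Q ω i := by
      rw [arrivingOp, arrivingOp, ih]; rfl
    rw [← Fin.succ_castSucc, pathOp_succ, pathOp_succ, h1, Fin.snoc_castSucc]
    rfl

theorem arrivingOp_snoc_castSucc (U : Circuit n (m + 1)) (Q : PauliString n)
    (ω : Fin m → SignType) (s : SignType) (i : Fin m) :
    arrivingOp U Q (Fin.snoc ω s : Fin (m + 1) → SignType) i.castSucc =
      arrivingOp U.init Q ω i := by
  rw [arrivingOp, arrivingOp, pathOp_snoc]; rfl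

/-- The operator that a path of the shortened circuit delivers to the last rotation. -/
noncomputable def lastArrivingOp (U : Circuit n (m + 1)) (Q : PauliString n)
    (ω : Fin m → SignType) : QOp n :=
  (U.clifford (Fin.last m))ᴴ * pathOp U.init Q ω (Fin.last m) * U.clifford (Fin.last m)

theorem arrivingOp_snoc_last (U : Circuit n (m + 1)) (Q : PauliString n)
    (ω : Fin m → SignType) (s : SignType) :
    arrivingOp U Q (Fin.snoc ω s : Fin (m + 1) → SignType) (Fin.last m) =
      lastArrivingOp U Q ω := by
  rw [arrivingOp, pathOp_snoc, lastArrivingOp]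

theorem isPath_snoc {U : Circuit n (m + 1)} {Q : PauliString n} {ω : Fin m → SignType}
    {s : SignType} : IsPath U Q (Fin.snoc ω s : Fin (m + 1) → SignType) ↔
      IsPath U.init Q ω ∧
        (s = 0 ↔ Commute (pauliOp (U.generator (Fin.last m))) (lastArrivingOp U Q ω)) := by
  rw [isPath_iff, isPath_iff, Fin.forall_fin_succ']
  simp only [arrivingOp_snoc_castSucc, arrivingOp_snoc_last, Fin.snoc_castSucc, Fin.snoc_last]
  rfl

open Classical in
/-- The branching of Pauli paths at the last rotation: a path continues uniquely if the arriving
operator commutes with the generator, and otherwise has a cosine and a sine continuation. -/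
theorem sum_paths_succ {β : Type*} [AddCommMonoid β] (U : Circuit n (m + 1)) (Q : PauliString n)
    (F : (Fin (m + 1) → SignType) → β) :
    ∑ ω ∈ paths U Q, F ω = ∑ ω ∈ paths U.init Q,
      if Commute (pauliOp (U.generator (Fin.last m))) (lastArrivingOp U Q ω) then
        F (Fin.snoc ω 0 : Fin (m + 1) → SignType)
      else F (Fin.snoc ω 1 : Fin (m + 1) → SignType) +
        F (Fin.snoc ω (-1) : Fin (m + 1) → SignType) := by
  have huniv : ∀ g : SignType → β, ∑ s, g s = g 0 + (g 1 + g (-1)) := by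
    intro g
    rw [show (Finset.univ : Finset SignType) = {0, 1, -1} by decide]
    rw [Finset.sum_insert (by decide), Finset.sum_insert (by decide), Finset.sum_singleton]
  rw [paths, Finset.sum_filter, paths, Finset.sum_filter,
    ← (Fin.snocEquiv fun _ : Fin (m + 1) => SignType).sum_comp, Fintype.sum_prod_type_right]
  refine Finset.sum_congr rfl fun ω _ => ?_
  rw [huniv]
  have hsnoc : ∀ s : SignType, (Fin.snocEquiv fun _ : Fin (m + 1) => SignType) (s, ω) =
    (Fin.snoc ω s : Fin (m + 1) → SignType) := fun s => rfl
  simp only [hsnoc, isPath_snoc]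
  by_cases h1 : IsPath U.init Q ω <;>
    by_cases h2 : Commute (pauliOp (U.generator (Fin.last m))) (lastArrivingOp U Q ω) <;>
    simp [h1, h2]

theorem Circuit.unitary_succ (U : Circuit n (m + 1)) (α : Fin (m + 1) → ℝ) :
    U.unitary α = U.init.unitary (fun i => α i.castSucc) *
      (U.clifford (Fin.last m) * rotation (U.generator (Fin.last m)) (α (Fin.last m))) := by
  rw [Circuit.unitary, List.ofFn_succ', List.concat_eq_append, List.prod_append,
    List.prod_singleton]
  rfl

theorem pathCoeff_snoc (ω : Fin m → SignType) (s : SignType) (α : Fin (m + 1) → ℝ) :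
    pathCoeff (Fin.snoc ω s : Fin (m + 1) → SignType) α =
      pathCoeff ω (fun i => α i.castSucc) * pathFactor s (α (Fin.last m)) := by
  rw [pathCoeff, Fin.prod_univ_castSucc]
  simp [pathCoeff]

theorem prod_snoc (g : SignType → ℝ) (ω : Fin m → SignType) (s : SignType) :
    ∏ i, g ((Fin.snoc ω s : Fin (m + 1) → SignType) i) = (∏ i, g (ω i)) * g s := by
  rw [Fin.prod_univ_castSucc]
  simp

/-- Back-propagation of a Pauli string through the whole circuit is the sum over its Pauli
paths. -/
theorem unitary_conj_pauliOp (U : Circuit n m) (Q : PauliString n) (α : Fin m → ℝ) :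
    (U.unitary α)ᴴ * pauliOp Q * U.unitary α =
      ∑ ω ∈ paths U Q, (pathCoeff ω α : ℂ) • pathOp U Q ω (Fin.last m) := by
  induction m with
  | zero =>
    rw [paths_zero]
    simp [Circuit.unitary, pathCoeff]
    rfl
  | succ m ih =>
    classical
    rw [Circuit.unitary_succ, Matrix.conjTranspose_mul, Matrix.conjTranspose_mul]
    set V := U.init.unitary fun i => α i.castSucc
    set C := U.clifford (Fin.last m) with hC
    set P := U.generator (Fin.last m) with hP
    set W := rotation P (α (Fin.last m))
    have h1 : Wᴴ * Cᴴ * Vᴴ * pauliOp Q * (V * (C * W)) =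
        Wᴴ * (Cᴴ * (Vᴴ * pauliOp Q * V) * C) * W := by noncomm_ring
    rw [h1, ih U.init, sum_paths_succ, Finset.mul_sum, Finset.sum_mul, Finset.mul_sum,
      Finset.sum_mul]
    refine Finset.sum_congr rfl fun ω hω => ?_
    have h2 : Wᴴ * (Cᴴ * ((pathCoeff ω (fun i => α i.castSucc) : ℂ) •
          pathOp U.init Q ω (Fin.last m)) * C) * W =
        (pathCoeff ω (fun i => α i.castSucc) : ℂ) • (Wᴴ * lastArrivingOp U Q ω * W) := by
      rw [lastArrivingOp]
      simp only [mul_smul_comm, smul_mul_assoc]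
      rfl
    have hop : ∀ s : SignType, pathOp U Q (Fin.snoc ω s : Fin (m + 1) → SignType)
        (Fin.last (m + 1)) = if s = -1 then (Complex.I / 2) • (pauliOp P * lastArrivingOp U Q ω -
          lastArrivingOp U Q ω * pauliOp P) else lastArrivingOp U Q ω := by
      intro s
      rw [← Fin.succ_last, pathOp_succ, arrivingOp_snoc_last, Fin.snoc_last]
    rw [h2]
    simp only [hop, pathCoeff_snoc]
    split_ifs with hc h3 h4
    · exact absurd h3 (by decide)
    · rw [rotation_conj_of_commute _ hc]
      simp [pathFactor]
    · exact absurd h4 (by decide)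
    · obtain ⟨R, hR⟩ := (mem_paths.1 hω).exists_isSignedPauli (Fin.last m)
      obtain ⟨R', hR'⟩ := hR.clifford_conj (U.isClifford (Fin.last m))
      have hanti := (hR'.comm_or_anticomm P).resolve_left hc
      rw [show Wᴴ * lastArrivingOp U Q ω * W = _ from
        rotation_conj_of_anticommute (α (Fin.last m)) hanti]
      have hs1 : ((1 : SignType) = 0) = False := by simp
      have hs2 : ((-1 : SignType) = 0) = False := by simp
      have hs3 : ((-1 : SignType) = 1) = False := by simp
      simp only [pathFactor, hs1, hs2, hs3, if_false, if_true, smul_add, smul_smul,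
        Complex.ofReal_mul, ← mul_assoc]

/-! ### Counting and weighting paths -/

/-- Multiplicative weights on the branches bound the total weight of all paths. -/
theorem sum_paths_prod_le (U : Circuit n m) (Q : PauliString n) {g : SignType → ℝ} {G : ℝ}
    (h0 : ∀ s, 0 ≤ g s) (h1 : g 0 ≤ G) (h2 : g 1 + g (-1) ≤ G) :
    ∑ ω ∈ paths U Q, ∏ i, g (ω i) ≤ G ^ m := by
  induction m with
  | zero =>
    rw [paths_zero]
    simp
  | succ m ih =>
    classical
    rw [sum_paths_succ]
    simp only [prod_snoc, ← mul_add, ← mul_ite]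
    calc _ ≤ ∑ ω ∈ paths U.init Q, (∏ i, g (ω i)) * G := by
          refine Finset.sum_le_sum fun ω _ =>
            mul_le_mul_of_nonneg_left ?_ (Finset.prod_nonneg fun i _ => h0 _)
          split_ifs <;> assumption
      _ ≤ G ^ m * G := by
          rw [← Finset.sum_mul]
          exact mul_le_mul_of_nonneg_right (ih _) ((h0 0).trans h1)
      _ = G ^ (m + 1) := (pow_succ _ _).symm

/-- Branching probabilities give a probability distribution on the paths. -/
theorem sum_paths_prod_eq_one (U : Circuit n m) (Q : PauliString n) {g : SignType → ℝ}
    (h1 : g 0 = 1) (h2 : g 1 + g (-1) = 1) :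
    ∑ ω ∈ paths U Q, ∏ i, g (ω i) = 1 := by
  induction m with
  | zero =>
    rw [paths_zero]
    simp
  | succ m ih =>
    classical
    rw [sum_paths_succ]
    simp only [prod_snoc, ← mul_add, h1, h2, ite_self, mul_one]
    exact ih _

theorem pow_numSines (ω : Fin m → SignType) (x : ℝ) :
    x ^ numSines ω = ∏ i, if ω i = -1 then x else 1 := by
  rw [Finset.prod_ite, Finset.prod_const, Finset.prod_const_one, mul_one, numSines]

theorem card_paths_le (U : Circuit n m) (Q : PauliString n) : ((paths U Q).card : ℝ) ≤ 2 ^ m := by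
  have := sum_paths_prod_le U Q (g := fun _ => 1) (G := 2) (by simp) (by simp) (by norm_num)
  simpa using this

/-- The number of paths with at most `κ ≤ m` sines, from the generating function
`∑_ω x ^ #sin(ω) ≤ (1 + x) ^ m` at `x = κ / m`. -/
theorem card_retainedPaths_le (U : Circuit n m) {κ : ℕ} (Q : PauliString n) (hκ : 1 ≤ κ)
    (hκm : κ ≤ m) : ((retainedPaths U κ Q).card : ℝ) ≤ (Real.exp 1 * m / κ) ^ κ := by
  have hκ0 : (0 : ℝ) < κ := by exact_mod_cast hκ
  have hm0 : (0 : ℝ) < m := by exact_mod_cast hκ.trans hκm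
  set x : ℝ := κ / m with hx
  have hx0 : 0 < x := by positivity
  have hx1 : x ≤ 1 := by
    rw [hx, div_le_one hm0]; exact_mod_cast hκm
  have h1 : ((retainedPaths U κ Q).card : ℝ) * x ^ κ ≤ (1 + x) ^ m := by
    calc ((retainedPaths U κ Q).card : ℝ) * x ^ κ
        = ∑ ω ∈ retainedPaths U κ Q, x ^ κ := by simp
      _ ≤ ∑ ω ∈ retainedPaths U κ Q, x ^ numSines ω := by
          refine Finset.sum_le_sum fun ω hω => ?_
          rw [retainedPaths_eq, Finset.mem_filter] at hω
          exact pow_le_pow_of_le_one hx0.le hx1 hω.2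
      _ ≤ ∑ ω ∈ paths U Q, x ^ numSines ω := by
          rw [retainedPaths_eq]
          exact Finset.sum_le_sum_of_subset_of_nonneg (Finset.filter_subset _ _)
            fun _ _ _ => by positivity
      _ ≤ (1 + x) ^ m := by
          simp only [pow_numSines]
          exact sum_paths_prod_le U Q (g := fun s => if s = -1 then x else 1)
            (fun s => by split_ifs <;> positivity)
            (by rw [if_neg (by decide)]; linarith)
            (by rw [if_neg (by decide), if_pos rfl])
  have h2 : (1 + x) ^ m ≤ Real.exp 1 ^ κ := by
    calc (1 + x) ^ m ≤ Real.exp x ^ m := by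
          gcongr; rw [add_comm]; exact Real.add_one_le_exp x
      _ = Real.exp 1 ^ κ := by
          rw [← Real.exp_nat_mul, ← Real.exp_nat_mul, hx]
          congr 1; field_simp
  have h3 : Real.exp 1 * m / κ = Real.exp 1 / x := by
    rw [hx]; field_simp
  rw [h3, div_pow, le_div_iff₀ (by positivity)]
  exact h1.trans h2

/-! ### Pauli weights along paths -/

theorem IsSingleQubitCliffordLayer.exists_conj {C : QOp n} (hC : IsSingleQubitCliffordLayer C)
    (R : PauliString n) : ∃ R', IsSignedPauli (Cᴴ * pauliOp R * C) R' ∧ weight R' = weight R := by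
  obtain ⟨V, hV, rfl⟩ := hC
  have hq : ∀ q, ∃ (s : ℂ) (p : Option PauliAxis), (s = 1 ∨ s = -1) ∧ (p = none ↔ R q = none) ∧
      (V q)ᴴ * pauliMatrix (R q) * V q = s • pauliMatrix p := by
    intro q
    cases hR : R q with
    | none =>
      refine ⟨1, none, .inl rfl, Iff.rfl, ?_⟩
      have : (V q)ᴴ * V q = 1 := Matrix.mem_unitaryGroup_iff'.1 (hV q).1
      simpa [pauliMatrix] using this
    | some a =>
      obtain ⟨b, hb | hb⟩ := (hV q).2 a
      · exact ⟨1, some b, .inl rfl, by simp, by simpa [pauliMatrix] using hb⟩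
      · exact ⟨-1, some b, .inr rfl, by simp, by simpa [pauliMatrix] using hb⟩
  choose s R' hs hw h using hq
  refine ⟨R', ?_, ?_⟩
  · have hconj : (tensorOp V)ᴴ * pauliOp R * tensorOp V = (∏ q, s q) • pauliOp R' := by
      rw [pauliOp, tensorOp_conjTranspose, tensorOp_mul, tensorOp_mul, pauliOp, ← tensorOp_smul]
      exact congrArg tensorOp (funext h)
    have hprod : (∏ q, s q) = 1 ∨ (∏ q, s q) = -1 := by
      refine Finset.prod_induction s (fun z => z = 1 ∨ z = -1) ?_ (.inl rfl) fun q _ => hs q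
      rintro a b (rfl | rfl) (rfl | rfl) <;> simp
    rw [IsSignedPauli, hconj]
    rcases hprod with h1 | h1 <;> simp [h1]
  · simp only [weight, ne_eq, hw]

/-- Single-qubit Clifford layers preserve Pauli weights, and each sine branch adds at most the
weight of its generator. -/
theorem IsPath.weight_le {U : Circuit n m} {Q : PauliString n} {ω : Fin m → SignType} {l : ℕ}
    (hC : ∀ i, IsSingleQubitCliffordLayer (U.clifford i)) (hl : ∀ i, weight (U.generator i) ≤ l)
    (h : IsPath U Q ω) {R : PauliString n}
    (hR : IsSignedPauli (pathOp U Q ω (Fin.last m)) R) :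
    weight R ≤ weight Q + numSines ω * l := by
  have key : ∀ j : Fin (m + 1), ∃ R, IsSignedPauli (pathOp U Q ω j) R ∧
      weight R ≤ weight Q + (univ.filter fun i : Fin m => i.castSucc < j ∧ ω i = -1).card * l := by
    intro j
    induction j using Fin.induction with
    | zero => exact ⟨Q, .inl rfl, by simp⟩
    | succ i ih =>
      obtain ⟨R, hR, hw⟩ := ih
      obtain ⟨R', hR', hw'⟩ : ∃ R', IsSignedPauli (arrivingOp U Q ω i) R' ∧
          weight R' = weight R := by
        obtain ⟨R', hR', hw'⟩ := (hC i).exists_conj R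
        refine ⟨R', ?_, hw'⟩
        rcases hR with hR | hR <;> rw [arrivingOp, hR]
        · exact hR'
        · rw [mul_neg, neg_mul]
          exact hR'.neg
      have hsub : (univ.filter fun k : Fin m => k.castSucc < i.castSucc ∧ ω k = -1) ⊆
          univ.filter fun k : Fin m => k.castSucc < i.succ ∧ ω k = -1 := by
        intro k hk
        simp only [mem_filter, mem_univ, true_and] at hk ⊢
        exact ⟨hk.1.trans i.castSucc_lt_succ, hk.2⟩
      rw [pathOp_succ]
      split_ifs with hi
      · rcases hR'.comm_or_anticomm (U.generator i) with hc | hc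
        · exact absurd ((h i).2 hc) (by rw [hi]; decide)
        · rw [half_commutator_eq hc]
          obtain ⟨R'', hR'', hw''⟩ := hR'.exists_I_smul_mul hc
          refine ⟨R'', hR'', ?_⟩
          have hlt : (univ.filter fun k : Fin m => k.castSucc < i.castSucc ∧ ω k = -1).card + 1 ≤
              (univ.filter fun k : Fin m => k.castSucc < i.succ ∧ ω k = -1).card := by
            refine Finset.card_lt_card (Finset.ssubset_iff_subset_ne.2 ⟨hsub, fun he => ?_⟩)
            have : i ∈ univ.filter fun k : Fin m => k.castSucc < i.succ ∧ ω k = -1 := by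
              simp [hi]
            rw [← he] at this
            simp at this
          have := Nat.mul_le_mul_right l hlt
          have := hl i
          rw [add_mul] at *
          omega
      · exact ⟨R', hR', by
          rw [hw']
          exact hw.trans
            (Nat.add_le_add_left (Nat.mul_le_mul_right l (Finset.card_le_card hsub)) _)⟩
  obtain ⟨R₀, hR₀, hw⟩ := key (Fin.last m)
  rw [hR.unique hR₀]
  simpa [numSines, Fin.castSucc_lt_last] using hw

/-! ### Second moments over the hypercube -/

/-- The uniform distribution of a single angle on `[-r, r]`. -/
noncomputable def uniformAngle (r : ℝ) : Measure ℝ :=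
  ProbabilityTheory.cond volume (Set.Icc (-r) r)

theorem isProbabilityMeasure_uniformAngle {r : ℝ} (hr : 0 < r) :
    IsProbabilityMeasure (uniformAngle r) := by
  refine ProbabilityTheory.cond_isProbabilityMeasure_of_finite ?_ ?_
  · rw [Real.volume_Icc]
    simpa using hr
  · rw [Real.volume_Icc]
    exact ENNReal.ofReal_ne_top

theorem uniformCube_eq_pi (m : ℕ) {r : ℝ} (hr : 0 < r) :
    uniformCube m r = Measure.pi fun _ : Fin m => uniformAngle r := by
  have := isProbabilityMeasure_uniformAngle hr
  refine (Measure.pi_eq fun s _ => ?_).symm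
  have hcube : cube m r = Set.univ.pi fun _ : Fin m => Set.Icc (-r) r := (Set.pi_univ_Icc _ _).symm
  rw [uniformCube, hcube,
    ProbabilityTheory.cond_apply (MeasurableSet.univ_pi fun _ => measurableSet_Icc),
    ← Set.pi_inter_distrib, volume_pi_pi, volume_pi_pi]
  simp only [uniformAngle, ProbabilityTheory.cond_apply measurableSet_Icc]
  rw [Finset.prod_mul_distrib, ENNReal.prod_inv_distrib]
  intro i _ j _ _
  right
  rw [Real.volume_Icc]
  exact ENNReal.ofReal_ne_top

theorem integrable_uniformCube {r : ℝ} (hr : 0 < r) {f : (Fin m → ℝ) → ℝ} (hf : Continuous f) :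
    Integrable f (uniformCube m r) := by
  have hpos : volume (cube m r) ≠ 0 := by
    have hcube : cube m r = Set.univ.pi fun _ : Fin m => Set.Icc (-r) r :=
      (Set.pi_univ_Icc _ _).symm
    rw [hcube, volume_pi_pi]
    refine Finset.prod_ne_zero_iff.2 fun i _ => ?_
    rw [Real.volume_Icc]
    simpa using hr
  exact (hf.continuousOn.integrableOn_compact isCompact_Icc).smul_measure
    (ENNReal.inv_ne_top.2 hpos)

theorem integrable_uniformAngle {r : ℝ} (hr : 0 < r) {f : ℝ → ℝ} (hf : Continuous f) :
    Integrable f (uniformAngle r) := by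
  refine (hf.continuousOn.integrableOn_compact isCompact_Icc).smul_measure
    (ENNReal.inv_ne_top.2 ?_)
  rw [Real.volume_Icc]
  simpa using hr

theorem integral_uniformAngle {r : ℝ} (hr : 0 < r) (f : ℝ → ℝ) :
    ∫ x, f x ∂uniformAngle r = (2 * r)⁻¹ * ∫ x in (-r)..r, f x := by
  rw [uniformAngle, ProbabilityTheory.cond, integral_smul_measure, Real.volume_Icc,
    intervalIntegral.integral_of_le (by linarith), integral_Icc_eq_integral_Ioc, smul_eq_mul,
    ENNReal.toReal_inv, ENNReal.toReal_ofReal (by linarith)]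
  congr 2
  ring

theorem continuous_pathFactor (s : SignType) : Continuous (pathFactor s) := by
  unfold pathFactor
  split_ifs
  · exact continuous_const
  · exact Real.continuous_cos
  · exact Real.continuous_sin

theorem continuous_pathCoeff (ω : Fin m → SignType) : Continuous (pathCoeff ω) :=
  continuous_finsetProd _ fun i _ => (continuous_pathFactor (ω i)).comp (continuous_apply i)

/-- The second moment of the factor that a path picks up at one rotation. -/
noncomputable def branchWeight (r : ℝ) (s : SignType) : ℝ :=
  ∫ θ, pathFactor s θ * pathFactor s θ ∂uniformAngle r

theorem branchWeight_nonneg (r : ℝ) (s : SignType) : 0 ≤ branchWeight r s :=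
  integral_nonneg fun _ => mul_self_nonneg _

theorem branchWeight_zero {r : ℝ} (hr : 0 < r) : branchWeight r 0 = 1 := by
  have := isProbabilityMeasure_uniformAngle hr
  simp [branchWeight, pathFactor]

theorem pathFactor_one : pathFactor 1 = Real.cos := by
  ext θ; simp [pathFactor]

theorem pathFactor_neg_one : pathFactor (-1) = Real.sin := by
  ext θ; simp [pathFactor]

theorem branchWeight_one_add_neg_one {r : ℝ} (hr : 0 < r) :
    branchWeight r 1 + branchWeight r (-1) = 1 := by
  have := isProbabilityMeasure_uniformAngle hr
  have hint : ∀ s, Integrable (fun θ => pathFactor s θ * pathFactor s θ) (uniformAngle r) :=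
    fun s => integrable_uniformAngle hr ((continuous_pathFactor s).mul (continuous_pathFactor s))
  rw [branchWeight, branchWeight, ← integral_add (hint 1) (hint (-1))]
  simp only [pathFactor_one, pathFactor_neg_one, ← sq, Real.cos_sq_add_sin_sq]
  simp

theorem branchWeight_neg_one_le {r : ℝ} (hr : 0 < r) : branchWeight r (-1) ≤ r ^ 2 / 3 := by
  have h1 : branchWeight r (-1) ≤ ∫ θ, θ ^ 2 ∂uniformAngle r := by
    refine integral_mono
      (integrable_uniformAngle hr ((continuous_pathFactor _).mul (continuous_pathFactor _)))
      (integrable_uniformAngle hr (continuous_pow 2)) fun θ => ?_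
    simp only [pathFactor_neg_one, ← sq]
    exact Real.sin_sq_le_sq
  refine h1.trans_eq ?_
  rw [integral_uniformAngle hr, integral_pow]
  field_simp
  ring

/-- Sine and cosine are orthogonal over a symmetric interval. -/
theorem integral_pathFactor_mul_eq_zero {r : ℝ} (hr : 0 < r) {s s' : SignType} (hs : s ≠ 0)
    (hs' : s' ≠ 0) (hne : s ≠ s') :
    ∫ θ, pathFactor s θ * pathFactor s' θ ∂uniformAngle r = 0 := by
  have key : ∫ θ, Real.sin θ * Real.cos θ ∂uniformAngle r = 0 := by
    rw [integral_uniformAngle hr, integral_sin_mul_cos₁]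
    simp
  rcases SignType.trichotomy s with rfl | rfl | rfl
  · rcases SignType.trichotomy s' with rfl | rfl | rfl
    · exact absurd rfl hne
    · exact absurd rfl hs'
    · simpa only [pathFactor_one, pathFactor_neg_one] using key
  · exact absurd rfl hs
  · rcases SignType.trichotomy s' with rfl | rfl | rfl
    · simpa only [pathFactor_one, pathFactor_neg_one, mul_comm] using key
    · exact absurd rfl hs'
    · exact absurd rfl hne

/-- The second moment `E[Φ_ω²]` of the coefficient of a path. Over the paths of one Pauli string
these are the probabilities of a random walk down the tree of branchings. -/
noncomputable def pathWeight (r : ℝ) (ω : Fin m → SignType) : ℝ := ∏ i, branchWeight r (ω i)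

theorem pathWeight_nonneg (r : ℝ) (ω : Fin m → SignType) : 0 ≤ pathWeight r ω :=
  Finset.prod_nonneg fun _ _ => branchWeight_nonneg r _

theorem integral_pathCoeff_mul {r : ℝ} (hr : 0 < r) (ω ω' : Fin m → SignType) :
    ∫ α, pathCoeff ω α * pathCoeff ω' α ∂uniformCube m r =
      ∏ i, ∫ θ, pathFactor (ω i) θ * pathFactor (ω' i) θ ∂uniformAngle r := by
  have := isProbabilityMeasure_uniformAngle hr
  simp only [pathCoeff, ← Finset.prod_mul_distrib]
  rw [uniformCube_eq_pi m hr]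
  exact integral_fintype_prod_eq_prod
    (fun i θ => pathFactor (ω i) θ * pathFactor (ω' i) θ)

/-- Distinct paths of the same Pauli string have uncorrelated coefficients: where they first
differ, the operators that arrive agree, so one path takes the cosine and the other the sine. -/
theorem integral_pathCoeff_mul_eq_zero {r : ℝ} (hr : 0 < r) {U : Circuit n m}
    {Q : PauliString n} {ω ω' : Fin m → SignType} (h : IsPath U Q ω) (h' : IsPath U Q ω')
    (hne : ω ≠ ω') : ∫ α, pathCoeff ω α * pathCoeff ω' α ∂uniformCube m r = 0 := by
  rw [integral_pathCoeff_mul hr]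
  have hnonempty : (univ.filter fun i => ω i ≠ ω' i).Nonempty := by
    obtain ⟨i, hi⟩ := Function.ne_iff.1 hne
    exact ⟨i, by simpa using hi⟩
  set i := (univ.filter fun i => ω i ≠ ω' i).min' hnonempty
  have hi : ω i ≠ ω' i := by
    simpa using (univ.filter fun i => ω i ≠ ω' i).min'_mem hnonempty
  have hlt : ∀ j < i, ω j = ω' j := by
    intro j hj
    by_contra hcon
    exact absurd ((univ.filter fun i => ω i ≠ ω' i).min'_le j (by simpa using hcon)) (not_le.2 hj)
  have hiff : ω i = 0 ↔ ω' i = 0 := by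
    rw [h i, h' i, pathOp_congr U Q i hlt]
  refine Finset.prod_eq_zero (Finset.mem_univ i) ?_
  have h0 : ω i ≠ 0 := fun h0 => hi (h0.trans (hiff.1 h0).symm)
  exact integral_pathFactor_mul_eq_zero hr h0 (fun h0' => h0 (hiff.2 h0')) hi

theorem integral_sum_paths_sq {r : ℝ} (hr : 0 < r) (U : Circuit n m) (Q : PauliString n)
    (x : (Fin m → SignType) → ℝ) :
    ∫ α, (∑ ω ∈ paths U Q, pathCoeff ω α * x ω) ^ 2 ∂uniformCube m r =
      ∑ ω ∈ paths U Q, pathWeight r ω * x ω ^ 2 := by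
  have hint : ∀ ω ω' : Fin m → SignType, Integrable
      (fun α => x ω * x ω' * (pathCoeff ω α * pathCoeff ω' α)) (uniformCube m r) := fun ω ω' =>
    integrable_uniformCube hr
      (((continuous_pathCoeff ω).mul (continuous_pathCoeff ω')).const_mul _)
  have hexpand : ∀ α, (∑ ω ∈ paths U Q, pathCoeff ω α * x ω) ^ 2 =
      ∑ ω ∈ paths U Q, ∑ ω' ∈ paths U Q, x ω * x ω' * (pathCoeff ω α * pathCoeff ω' α) := by
    intro α
    rw [sq, Finset.sum_mul_sum]
    refine Finset.sum_congr rfl fun ω _ => Finset.sum_congr rfl fun ω' _ => by ring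
  simp only [hexpand]
  rw [integral_finsetSum _ fun ω _ => integrable_finsetSum _ fun ω' _ => hint ω ω']
  refine Finset.sum_congr rfl fun ω hω => ?_
  rw [integral_finsetSum _ fun ω' _ => hint ω ω', Finset.sum_eq_single_of_mem ω hω]
  · rw [integral_const_mul, integral_pathCoeff_mul hr, pathWeight]
    simp only [branchWeight]
    ring
  · intro ω' hω' hne
    rw [integral_const_mul,
      integral_pathCoeff_mul_eq_zero hr (mem_paths.1 hω) (mem_paths.1 hω') hne.symm, mul_zero]

theorem sum_mul_sq_le {ι : Type*} (s : Finset ι) (a x : ι → ℝ) :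
    (∑ i ∈ s, a i * x i) ^ 2 ≤ (∑ i ∈ s, |a i|) * ∑ i ∈ s, |a i| * x i ^ 2 := by
  refine Finset.sum_sq_le_sum_mul_sum_of_sq_le_mul s (fun i _ => abs_nonneg _)
    (fun i _ => by positivity) fun i _ => ?_
  rw [mul_pow, ← sq_abs (a i)]
  exact le_of_eq (by ring)

/-- The mean square of a linear combination of path coefficients, by orthogonality for each Pauli
string and the Cauchy–Schwarz inequality across the Pauli strings of the observable. -/
theorem integral_sum_sum_paths_sq_le {r : ℝ} (hr : 0 < r) (U : Circuit n m)
    (a : PauliString n → ℝ) (x : PauliString n → (Fin m → SignType) → ℝ) :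
    ∫ α, (∑ Q, a Q * ∑ ω ∈ paths U Q, pathCoeff ω α * x Q ω) ^ 2 ∂uniformCube m r ≤
      norm₁ a * ∑ Q, |a Q| * ∑ ω ∈ paths U Q, pathWeight r ω * x Q ω ^ 2 := by
  have hcont : ∀ Q, Continuous fun α : Fin m → ℝ => ∑ ω ∈ paths U Q, pathCoeff ω α * x Q ω :=
    fun Q => continuous_finsetSum _ fun ω _ => (continuous_pathCoeff ω).mul_const _
  calc _ ≤ ∫ α, norm₁ a * ∑ Q, |a Q| * (∑ ω ∈ paths U Q, pathCoeff ω α * x Q ω) ^ 2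
        ∂uniformCube m r := by
        refine integral_mono (integrable_uniformCube hr ?_) (integrable_uniformCube hr ?_)
          fun α => sum_mul_sq_le _ _ _
        · exact (continuous_finsetSum _ fun Q _ => (hcont Q).const_mul _).pow 2
        · exact (continuous_finsetSum _ fun Q _ => ((hcont Q).pow 2).const_mul _).const_mul _
    _ = _ := by
        have hint : ∀ Q, Integrable (fun α => |a Q| *
            (∑ ω ∈ paths U Q, pathCoeff ω α * x Q ω) ^ 2) (uniformCube m r) := fun Q =>
          integrable_uniformCube hr (((hcont Q).pow 2).const_mul _)
        rw [integral_const_mul, integral_finsetSum _ fun Q _ => hint Q]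
        congr 1
        refine Finset.sum_congr rfl fun Q _ => ?_
        rw [integral_const_mul, integral_sum_paths_sq hr]

theorem sum_pathWeight {r : ℝ} (hr : 0 < r) (U : Circuit n m) (Q : PauliString n) :
    ∑ ω ∈ paths U Q, pathWeight r ω = 1 :=
  sum_paths_prod_eq_one U Q (branchWeight_zero hr) (branchWeight_one_add_neg_one hr)

/-- The exponential moment of the number of sines along a random path, which is dominated by a sum
of `m` independent Bernoulli variables of mean `r² / 3`. -/
theorem sum_pathWeight_mul_pow_le {r : ℝ} (hr : 0 < r) (U : Circuit n m) (Q : PauliString n)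
    {t : ℝ} (ht : 1 ≤ t) :
    ∑ ω ∈ paths U Q, pathWeight r ω * t ^ numSines ω ≤ Real.exp (m * r ^ 2 * t / 3) := by
  have h0 := branchWeight_nonneg r (-1)
  have h1 := branchWeight_neg_one_le hr
  have h2 := branchWeight_one_add_neg_one hr
  simp only [pathWeight, pow_numSines, ← Finset.prod_mul_distrib]
  refine (sum_paths_prod_le U Q
    (g := fun s => branchWeight r s * if s = -1 then t else 1) (G := Real.exp (r ^ 2 * t / 3))
    (fun s => mul_nonneg (branchWeight_nonneg r s) (by split_ifs <;> linarith)) ?_ ?_).trans_eq ?_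
  · rw [if_neg (by decide), branchWeight_zero hr, one_mul]
    exact Real.one_le_exp (by positivity)
  · rw [if_neg (by decide), if_pos rfl]
    have : branchWeight r (-1) * t ≤ r ^ 2 / 3 * t := mul_le_mul_of_nonneg_right h1 (by linarith)
    have := Real.add_one_le_exp (r ^ 2 * t / 3)
    linarith
  · rw [← Real.exp_nat_mul]
    congr 1
    ring

/-- The Chernoff bound for the total weight of the paths with more than `κ` sines. -/
theorem sum_pathWeight_tail_le {r : ℝ} (hr : 0 < r) (hm : 1 ≤ m) (U : Circuit n m)
    (Q : PauliString n) {κ : ℕ} (hκ : 1 ≤ κ) (h : m * r ^ 2 ≤ 3 * κ) :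
    ∑ ω ∈ (paths U Q).filter (fun ω => ¬ numSines ω ≤ κ), pathWeight r ω ≤
      (Real.exp 1 * m * r ^ 2 / (3 * κ)) ^ κ := by
  have hm0 : (0 : ℝ) < m := by exact_mod_cast hm
  have hκ0 : (0 : ℝ) < κ := by exact_mod_cast hκ
  set t : ℝ := 3 * κ / (m * r ^ 2) with ht
  have ht1 : 1 ≤ t := by
    rw [ht, one_le_div (by positivity)]; exact h
  have ht0 : 0 < t := by linarith
  have h1 : (∑ ω ∈ (paths U Q).filter (fun ω => ¬ numSines ω ≤ κ), pathWeight r ω) * t ^ κ ≤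
      Real.exp 1 ^ κ := by
    calc _ ≤ ∑ ω ∈ (paths U Q).filter (fun ω => ¬ numSines ω ≤ κ),
          pathWeight r ω * t ^ numSines ω := by
          rw [Finset.sum_mul]
          refine Finset.sum_le_sum fun ω hω => mul_le_mul_of_nonneg_left
            (pow_le_pow_right₀ ht1 ?_) (pathWeight_nonneg r ω)
          exact (not_le.1 (Finset.mem_filter.1 hω).2).le
      _ ≤ ∑ ω ∈ paths U Q, pathWeight r ω * t ^ numSines ω :=
          Finset.sum_le_sum_of_subset_of_nonneg (Finset.filter_subset _ _)
            fun ω _ _ => mul_nonneg (pathWeight_nonneg r ω) (by positivity)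
      _ ≤ Real.exp (m * r ^ 2 * t / 3) := sum_pathWeight_mul_pow_le hr U Q ht1
      _ = Real.exp 1 ^ κ := by
          rw [← Real.exp_nat_mul, ht]
          congr 1
          field_simp
  have h2 : Real.exp 1 * m * r ^ 2 / (3 * κ) = Real.exp 1 / t := by
    rw [ht]; field_simp
  rw [h2, div_pow, le_div_iff₀ (by positivity)]
  exact h1

/-! ### Randomized Pauli measurements -/

/-- The contribution of one qubit to the single-shot estimator of a Pauli string: inverting the
measurement channel gives `3` times the outcome sign if the measured axis is the right one. -/
noncomputable def qubitEstimator (p : Option PauliAxis) (b : PauliAxis) (s : Fin 2) : ℝ :=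
  match p with
  | none => 1
  | some a => if a = b then 3 * (-1) ^ (s : ℕ) else 0

/-- The single-shot classical-shadow estimator of the expectation value of a Pauli string. -/
noncomputable def shotEstimator (P : PauliString n) (x : Shot n) : ℝ :=
  ∏ q, qubitEstimator (P q) (x.1 q) (x.2 q)

theorem abs_shotEstimator_le (P : PauliString n) (x : Shot n) :
    |shotEstimator P x| ≤ 3 ^ weight P := by
  have h : ∀ q, |qubitEstimator (P q) (x.1 q) (x.2 q)| ≤ if P q ≠ none then 3 else 1 := by
    intro q
    cases hP : P q with
    | none => simp [qubitEstimator]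
    | some a =>
      rw [if_pos (by simp), qubitEstimator]
      split_ifs <;> simp [abs_mul]
  rw [shotEstimator, Finset.abs_prod]
  refine (Finset.prod_le_prod (fun q _ => abs_nonneg _) fun q _ => h q).trans_eq ?_
  rw [Finset.prod_ite, Finset.prod_const, Finset.prod_const_one, mul_one, weight]

theorem univ_pauliAxis : (Finset.univ : Finset PauliAxis) = {.X, .Y, .Z} := rfl

theorem sum_qubitEstimator (p : Option PauliAxis) :
    ∑ i : PauliAxis × Fin 2, (((1 / 3) * qubitEstimator p i.1 i.2 : ℝ) : ℂ) •
      ((1 / 2 : ℂ) • (1 + (-1 : ℂ) ^ (i.2 : ℕ) • axisMatrix i.1)) = pauliMatrix p := by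
  have h : ∀ f : PauliAxis → Matrix (Fin 2) (Fin 2) ℂ, ∑ b, f b = f .X + (f .Y + f .Z) := by
    intro f
    rw [univ_pauliAxis, Finset.sum_insert (by decide), Finset.sum_insert (by decide),
      Finset.sum_singleton]
  rw [Fintype.sum_prod_type, h]
  rcases p with _ | a
  · simp [Fin.sum_univ_two, qubitEstimator, pauliMatrix]
    module
  · cases a <;> simp [Fin.sum_univ_two, qubitEstimator, pauliMatrix] <;> module

/-- The single-shot estimator is unbiased, as an identity of operators. -/
theorem sum_shotEstimator_smul (P : PauliString n) :
    ∑ x : Shot n, (((1 / 3) ^ n * shotEstimator P x : ℝ) : ℂ) • shotProjector x = pauliOp P := by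
  rw [← (Equiv.arrowProdEquivProdArrow (Fin n) (fun _ => PauliAxis) fun _ => Fin 2).sum_comp]
  have h : ∀ y : Fin n → PauliAxis × Fin 2, (((1 / 3) ^ n * shotEstimator P
      (Equiv.arrowProdEquivProdArrow (Fin n) (fun _ => PauliAxis) (fun _ => Fin 2) y) : ℝ) : ℂ) •
        shotProjector
          (Equiv.arrowProdEquivProdArrow (Fin n) (fun _ => PauliAxis) (fun _ => Fin 2) y) =
      tensorOp fun q => (((1 / 3) * qubitEstimator (P q) (y q).1 (y q).2 : ℝ) : ℂ) •
        ((1 / 2 : ℂ) • (1 + (-1 : ℂ) ^ ((y q).2 : ℕ) • axisMatrix (y q).1)) := by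
    intro y
    rw [tensorOp_smul, ← Complex.ofReal_prod, Finset.prod_mul_distrib, Finset.prod_const,
      Finset.card_univ, Fintype.card_fin]
    rfl
  simp only [h]
  refine (sum_tensorOp fun q (i : PauliAxis × Fin 2) =>
    (((1 / 3) * qubitEstimator (P q) i.1 i.2 : ℝ) : ℂ) •
      ((1 / 2 : ℂ) • (1 + (-1 : ℂ) ^ (i.2 : ℕ) • axisMatrix i.1))).trans ?_
  simp only [sum_qubitEstimator]
  rfl

theorem sum_shotProb_mul (ρ : QOp n) (P : PauliString n) :
    ∑ x, shotProb ρ x * shotEstimator P x = (pauliOp P * ρ).trace.re := by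
  rw [← sum_shotEstimator_smul P, Finset.sum_mul, Matrix.trace_sum, Complex.re_sum]
  refine Finset.sum_congr rfl fun x _ => ?_
  rw [smul_mul_assoc, Matrix.trace_smul, smul_eq_mul, Complex.re_ofReal_mul, shotProb]
  ring

theorem sum_shotProb {ρ : QOp n} (hρ : IsState ρ) : ∑ x, shotProb ρ x = 1 := by
  have h1 := sum_shotProb_mul ρ fun _ => none
  have h2 : pauliOp (fun _ : Fin n => none) = 1 := tensorOp_one
  simpa [shotEstimator, qubitEstimator, h2, hρ.2] using h1

theorem shotProb_nonneg {ρ : QOp n} (hρ : IsState ρ) (x : Shot n) : 0 ≤ shotProb ρ x := by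
  refine mul_nonneg (by positivity) (trace_mul_nonneg ?_ ?_ hρ.1)
  · rw [Matrix.IsHermitian, shotProjector, tensorOp_conjTranspose]
    refine congrArg tensorOp (funext fun q => ?_)
    rw [Matrix.conjTranspose_smul, Matrix.conjTranspose_add, Matrix.conjTranspose_smul,
      Matrix.conjTranspose_one, axisMatrix_conjTranspose]
    simp
  · rw [shotProjector, tensorOp_mul]
    refine congrArg tensorOp (funext fun q => ?_)
    have hs : (-1 : ℂ) ^ (x.2 q : ℕ) * (-1 : ℂ) ^ (x.2 q : ℕ) = 1 := by
      rw [← mul_pow]; simp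
    generalize (-1 : ℂ) ^ (x.2 q : ℕ) = s at hs
    rw [smul_mul_smul_comm, add_mul, mul_add, mul_add, smul_mul_smul_comm, axisMatrix_mul_self, hs,
      one_mul, mul_one, one_mul]
    module

/-! ### Concentration of weighted sums of squares -/

/-- Hoeffding's lemma for a bounded centred random variable on a finite probability space. -/
theorem sum_mul_exp_le {Ω : Type*} [Fintype Ω] {p Y : Ω → ℝ} (hp : ∀ x, 0 ≤ p x)
    (hp1 : ∑ x, p x = 1) (hY : ∑ x, p x * Y x = 0) {B : ℝ} (hB : 0 < B) (hYB : ∀ x, |Y x| ≤ B)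
    (t : ℝ) : ∑ x, p x * Real.exp (t * Y x) ≤ Real.exp (t ^ 2 * B ^ 2 / 2) := by
  -- the chord of the convex function `exp` over `[-tB, tB]`
  have hchord : ∀ x, Real.exp (t * Y x) ≤
      Real.cosh (t * B) + Y x * (Real.sinh (t * B) / B) := by
    intro x
    obtain ⟨h1, h2⟩ := abs_le.1 (hYB x)
    have h := convexOn_exp.2 (Set.mem_univ (t * B)) (Set.mem_univ (-(t * B)))
      (div_nonneg (by linarith) (by linarith) : 0 ≤ (B + Y x) / (2 * B))
      (div_nonneg (by linarith) (by linarith) : 0 ≤ (B - Y x) / (2 * B))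
      (by field_simp; ring)
    simp only [smul_eq_mul] at h
    have e1 : (B + Y x) / (2 * B) * (t * B) + (B - Y x) / (2 * B) * -(t * B) = t * Y x := by
      field_simp; ring
    rw [e1] at h
    refine h.trans_eq ?_
    rw [Real.cosh_eq, Real.sinh_eq]
    field_simp
    ring
  calc ∑ x, p x * Real.exp (t * Y x)
      ≤ ∑ x, p x * (Real.cosh (t * B) + Y x * (Real.sinh (t * B) / B)) :=
        Finset.sum_le_sum fun x _ => mul_le_mul_of_nonneg_left (hchord x) (hp x)
    _ = (∑ x, p x) * Real.cosh (t * B) + (∑ x, p x * Y x) * (Real.sinh (t * B) / B) := by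
        rw [Finset.sum_mul, Finset.sum_mul, ← Finset.sum_add_distrib]
        exact Finset.sum_congr rfl fun x _ => by ring
    _ = Real.cosh (t * B) := by rw [hp1, hY]; ring
    _ ≤ Real.exp ((t * B) ^ 2 / 2) := Real.cosh_le_exp_half_sq _
    _ = _ := by rw [mul_pow]

/-- The mean of `N` independent copies of a bounded centred random variable is sub-Gaussian with
variance proxy `B² / N`. -/
theorem sum_prod_mul_cosh_le {Ω : Type*} [Fintype Ω] {p Y : Ω → ℝ} (hp : ∀ x, 0 ≤ p x)
    (hp1 : ∑ x, p x = 1) (hY : ∑ x, p x * Y x = 0) {B : ℝ} (hB : 0 < B) (hYB : ∀ x, |Y x| ≤ B)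
    {N : ℕ} (hN : 0 < N) (t : ℝ) :
    ∑ d : Fin N → Ω, (∏ i, p (d i)) * Real.cosh (t * ((∑ i, Y (d i)) / N)) ≤
      Real.exp (t ^ 2 * B ^ 2 / (2 * N)) := by
  have hN0 : (0 : ℝ) < N := by exact_mod_cast hN
  have hexp : ∀ u : ℝ, ∑ d : Fin N → Ω, (∏ i, p (d i)) * Real.exp (u * ((∑ i, Y (d i)) / N)) ≤
      Real.exp (u ^ 2 * B ^ 2 / (2 * N)) := by
    intro u
    calc _ = ∑ d : Fin N → Ω, ∏ i, (p (d i) * Real.exp (u / N * Y (d i))) := by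
          refine Finset.sum_congr rfl fun d _ => ?_
          rw [Finset.prod_mul_distrib, ← Real.exp_sum, ← Finset.mul_sum]
          congr 2
          ring
      _ = (∑ x, p x * Real.exp (u / N * Y x)) ^ N :=
          (Fintype.sum_pow (fun x => p x * Real.exp (u / N * Y x)) N).symm
      _ ≤ Real.exp ((u / N) ^ 2 * B ^ 2 / 2) ^ N :=
          pow_le_pow_left₀ (Finset.sum_nonneg fun x _ => mul_nonneg (hp x) (Real.exp_nonneg _))
            (sum_mul_exp_le hp hp1 hY hB hYB _) _
      _ = _ := by
          rw [← Real.exp_nat_mul]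
          congr 1
          field_simp
  have h1 := hexp t
  have h2 := hexp (-t)
  rw [neg_sq] at h2
  have h3 : ∑ d : Fin N → Ω, (∏ i, p (d i)) * Real.cosh (t * ((∑ i, Y (d i)) / N)) =
      (∑ d : Fin N → Ω, (∏ i, p (d i)) * Real.exp (t * ((∑ i, Y (d i)) / N)) +
        ∑ d : Fin N → Ω, (∏ i, p (d i)) * Real.exp (-t * ((∑ i, Y (d i)) / N))) / 2 := by
    rw [← Finset.sum_add_distrib, Finset.sum_div]
    refine Finset.sum_congr rfl fun d _ => ?_
    rw [Real.cosh_eq, neg_mul]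
    ring
  rw [h3]
  linarith

/-- Jensen's inequality for the convex function `y ↦ cosh √y`, term by term in its power
series. -/
theorem cosh_sqrt_sum_le {ι : Type*} (s : Finset ι) {w z : ι → ℝ} (hw : ∀ i ∈ s, 0 ≤ w i)
    (hw1 : ∑ i ∈ s, w i = 1) :
    Real.cosh (√(∑ i ∈ s, w i * z i ^ 2)) ≤ ∑ i ∈ s, w i * Real.cosh (z i) := by
  refine hasSum_le (fun k => ?_) (Real.hasSum_cosh _)
    (hasSum_sum fun i _ => (Real.hasSum_cosh (z i)).mul_left (w i))
  rw [pow_mul, Real.sq_sqrt (Finset.sum_nonneg fun i hi => mul_nonneg (hw i hi) (sq_nonneg _))]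
  have h := Real.pow_arith_mean_le_arith_mean_pow s w (fun i => z i ^ 2) hw hw1
    (fun i _ => sq_nonneg _) k
  calc _ ≤ (∑ i ∈ s, w i * (z i ^ 2) ^ k) / ((2 * k).factorial : ℝ) := by gcongr
    _ = _ := by
        rw [Finset.sum_div]
        exact Finset.sum_congr rfl fun i _ => by rw [pow_mul]; ring

/-- A weighted sum of squares of sub-Gaussian variables with variance proxies `Bᵢ² σ` has the tail
of the square of a single sub-Gaussian variable with variance proxy `(∑ wᵢ Bᵢ²) σ`, without any
independence and whatever the number of terms. -/
theorem sum_filter_lt_weighted_sq_le {D ι : Type*} [Fintype D] {p : D → ℝ} (hp : ∀ d, 0 ≤ p d)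
    (s : Finset ι) {w B : ι → ℝ} {e : ι → D → ℝ} (hw : ∀ i ∈ s, 0 ≤ w i) (hB : ∀ i ∈ s, 0 < B i)
    {V σ T : ℝ} (hσ : 0 < σ) (hT : 0 < T) (hwV : ∑ i ∈ s, w i * B i ^ 2 ≤ V)
    (hmgf : ∀ i ∈ s, w i ≠ 0 → ∀ t : ℝ,
      ∑ d, p d * Real.cosh (t * e i d) ≤ Real.exp (t ^ 2 * B i ^ 2 * σ / 2)) :
    ∑ d ∈ univ.filter (fun d => T < ∑ i ∈ s, w i * e i d ^ 2), p d ≤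
      2 * Real.exp (-(T / (2 * V * σ))) := by
  set W := ∑ i ∈ s, w i * B i ^ 2 with hW
  have hW0 : 0 ≤ W := Finset.sum_nonneg fun i hi => mul_nonneg (hw i hi) (sq_nonneg _)
  rcases hW0.eq_or_lt with hW0 | hW0
  · -- all weights vanish
    have hzero : ∀ i ∈ s, w i = 0 := by
      intro i hi
      have h := (Finset.sum_eq_zero_iff_of_nonneg fun i hi =>
        mul_nonneg (hw i hi) (sq_nonneg (B i))).1 hW0.symm i hi
      rcases mul_eq_zero.1 h with h | h
      · exact h
      · exact absurd h (pow_pos (hB i hi) 2).ne'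
    rw [Finset.sum_eq_zero]
    · positivity
    · intro d hd
      have h := (Finset.mem_filter.1 hd).2
      rw [Finset.sum_eq_zero fun i hi => by rw [hzero i hi, zero_mul]] at h
      exact absurd h (not_lt.2 hT.le)
  -- the exponent that optimizes the Chernoff bound
  set t : ℝ := √T / (W * σ) with ht
  have ht0 : 0 < t := by positivity
  clear_value t
  set v : ι → ℝ := fun i => w i * B i ^ 2 / W with hv
  have hv0 : ∀ i ∈ s, 0 ≤ v i := fun i hi =>
    div_nonneg (mul_nonneg (hw i hi) (sq_nonneg _)) hW0.le
  have hv1 : ∑ i ∈ s, v i = 1 := by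
    rw [hv, ← Finset.sum_div, div_self hW0.ne']
  have hjensen : ∀ d, Real.cosh (√(t ^ 2 * ∑ i ∈ s, w i * e i d ^ 2)) ≤
      ∑ i ∈ s, v i * Real.cosh (t * √W / B i * e i d) := by
    intro d
    refine le_of_eq_of_le ?_
      (cosh_sqrt_sum_le s (z := fun i => t * √W / B i * e i d) hv0 hv1)
    congr 2
    rw [Finset.mul_sum]
    refine Finset.sum_congr rfl fun i hi => ?_
    have := (hB i hi).ne'
    simp only [hv]
    rw [mul_pow, div_pow, mul_pow, Real.sq_sqrt hW0.le]
    field_simp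
  have hmoment : ∑ d, p d * Real.cosh (√(t ^ 2 * ∑ i ∈ s, w i * e i d ^ 2)) ≤
      Real.exp (t ^ 2 * W * σ / 2) := by
    calc _ ≤ ∑ d, p d * ∑ i ∈ s, v i * Real.cosh (t * √W / B i * e i d) :=
          Finset.sum_le_sum fun d _ => mul_le_mul_of_nonneg_left (hjensen d) (hp d)
      _ = ∑ i ∈ s, v i * ∑ d, p d * Real.cosh (t * √W / B i * e i d) := by
          simp only [Finset.mul_sum]
          rw [Finset.sum_comm]
          exact Finset.sum_congr rfl fun i _ => Finset.sum_congr rfl fun d _ => by ring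
      _ ≤ ∑ i ∈ s, v i * Real.exp (t ^ 2 * W * σ / 2) := by
          refine Finset.sum_le_sum fun i hi => ?_
          by_cases hwi : w i = 0
          · simp [hv, hwi]
          · refine mul_le_mul_of_nonneg_left ((hmgf i hi hwi _).trans_eq ?_) (hv0 i hi)
            have := (hB i hi).ne'
            rw [div_pow, mul_pow, Real.sq_sqrt hW0.le]
            congr 1
            field_simp
      _ = Real.exp (t ^ 2 * W * σ / 2) := by rw [← Finset.sum_mul, hv1, one_mul]
  have hmarkov : (∑ d ∈ univ.filter (fun d => T < ∑ i ∈ s, w i * e i d ^ 2), p d) *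
      (Real.exp (t * √T) / 2) ≤ Real.exp (t ^ 2 * W * σ / 2) := by
    refine le_trans ?_ hmoment
    rw [Finset.sum_mul]
    refine (Finset.sum_le_sum fun d hd => ?_).trans
      (Finset.sum_le_sum_of_subset_of_nonneg (Finset.filter_subset _ _)
        fun d _ _ => mul_nonneg (hp d) (Real.cosh_pos _).le)
    refine mul_le_mul_of_nonneg_left ?_ (hp d)
    have h1 : t * √T ≤ √(t ^ 2 * ∑ i ∈ s, w i * e i d ^ 2) := by
      rw [Real.sqrt_mul (sq_nonneg t), Real.sqrt_sq ht0.le]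
      exact mul_le_mul_of_nonneg_left (Real.sqrt_le_sqrt (Finset.mem_filter.1 hd).2.le) ht0.le
    rw [Real.cosh_eq]
    have := Real.exp_le_exp.2 h1
    have := Real.exp_pos (-√(t ^ 2 * ∑ i ∈ s, w i * e i d ^ 2))
    linarith
  have hT2 : √T * √T = T := Real.mul_self_sqrt hT.le
  have hexpo : t ^ 2 * W * σ / 2 - t * √T = -(T / (2 * W * σ)) := by
    have e1 : t ^ 2 = T / (W * σ) ^ 2 := by rw [ht, div_pow, Real.sq_sqrt hT.le]
    have e2 : t * √T = T / (W * σ) := by rw [ht, div_mul_eq_mul_div, hT2]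
    rw [e1, e2]
    field_simp
    ring
  calc ∑ d ∈ univ.filter (fun d => T < ∑ i ∈ s, w i * e i d ^ 2), p d
      ≤ Real.exp (t ^ 2 * W * σ / 2) / (Real.exp (t * √T) / 2) := by
        rw [le_div_iff₀ (by positivity)]; exact hmarkov
    _ = 2 * Real.exp (-(T / (2 * W * σ))) := by
        rw [← hexpo, Real.exp_sub]; field_simp
    _ ≤ 2 * Real.exp (-(T / (2 * V * σ))) := by gcongr

/-! ### The error of the surrogate as a sum over paths -/

/-- The value at `M` of the linear functional that sends each Pauli string `P` to `y P`, for
operators `M` with real Pauli coefficients. -/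
noncomputable def pauliPairing (M : QOp n) (y : PauliString n → ℝ) : ℝ :=
  ∑ P, (pauliOp P * M).trace.re / 2 ^ n * y P

theorem IsSignedPauli.exists_sign {M : QOp n} {R : PauliString n} (h : IsSignedPauli M R) :
    ∃ s : ℝ, (s = 1 ∨ s = -1) ∧ M = (s : ℂ) • pauliOp R ∧ ∀ y, pauliPairing M y = s * y R := by
  obtain ⟨s, hs, hM, hc⟩ := h.exists_sum_coeff_eq
  exact ⟨s, hs, hM, fun y => by simp [pauliPairing, hc]⟩

theorem IsSignedPauli.pauliPairing_trace {M : QOp n} {R : PauliString n} (h : IsSignedPauli M R)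
    (ρ : QOp n) : pauliPairing M (fun P => (pauliOp P * ρ).trace.re) = (M * ρ).trace.re := by
  obtain ⟨s, -, hM, hy⟩ := h.exists_sign
  rw [hy, hM, smul_mul_assoc, Matrix.trace_smul, smul_eq_mul, Complex.re_ofReal_mul]

theorem truncatedCoeff_eq (U : Circuit n m) (κ : ℕ) (a : PauliString n → ℝ) (α : Fin m → ℝ)
    (P : PauliString n) : truncatedCoeff U κ a α P =
      ∑ Q, a Q * ∑ ω ∈ retainedPaths U κ Q,
        pathCoeff ω α * ((pauliOp P * pathOp U Q ω (Fin.last m)).trace.re / 2 ^ n) := by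
  simp only [truncatedCoeff, truncatedObservable, Finset.mul_sum, mul_smul_comm, Finset.smul_sum,
    Matrix.trace_sum, Matrix.trace_smul, Complex.re_sum, smul_eq_mul, Complex.re_ofReal_mul,
    Finset.sum_div, mul_div_assoc]

theorem sum_truncatedCoeff_mul (U : Circuit n m) (κ : ℕ) (a : PauliString n → ℝ)
    (α : Fin m → ℝ) (y : PauliString n → ℝ) : ∑ P, truncatedCoeff U κ a α P * y P =
      ∑ Q, a Q * ∑ ω ∈ retainedPaths U κ Q,
        pathCoeff ω α * pauliPairing (pathOp U Q ω (Fin.last m)) y := by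
  simp only [truncatedCoeff_eq, pauliPairing, Finset.mul_sum, Finset.sum_mul]
  rw [Finset.sum_comm]
  refine Finset.sum_congr rfl fun Q _ => ?_
  rw [Finset.sum_comm]
  exact Finset.sum_congr rfl fun ω _ => Finset.sum_congr rfl fun P _ => by ring

theorem expectation_eq (U : Circuit n m) (a : PauliString n → ℝ) (ρ : QOp n) (α : Fin m → ℝ) :
    expectation U a ρ α = ∑ Q, a Q * ∑ ω ∈ paths U Q,
      pathCoeff ω α * (pathOp U Q ω (Fin.last m) * ρ).trace.re := by
  have h : (observable a * U.unitary α * ρ * (U.unitary α)ᴴ).trace =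
      ((U.unitary α)ᴴ * observable a * U.unitary α * ρ).trace := by
    rw [Matrix.trace_mul_comm]
    simp only [mul_assoc]
  rw [expectation, h]
  have hobs : (U.unitary α)ᴴ * observable a * U.unitary α = ∑ Q, (a Q : ℂ) •
      ∑ ω ∈ paths U Q, (pathCoeff ω α : ℂ) • pathOp U Q ω (Fin.last m) := by
    simp only [observable, Finset.mul_sum, Finset.sum_mul, mul_smul_comm, smul_mul_assoc,
      unitary_conj_pauliOp]
  rw [hobs]
  simp only [Finset.sum_mul, Finset.mul_sum, smul_mul_assoc, Finset.smul_sum, Matrix.trace_sum,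
    Matrix.trace_smul, Complex.re_sum, smul_eq_mul, Complex.re_ofReal_mul]

/-- The error of the surrogate splits over the paths: retained paths contribute the error of the
estimate of their Pauli string, and discarded paths their exact expectation value. -/
theorem surrogate_sub_expectation_eq (U : Circuit n m) (κ : ℕ) (a : PauliString n → ℝ)
    (ρ : QOp n) (α : Fin m → ℝ) (o e : PauliString n → ℝ)
    (he : ∀ P, truncatedCoeff U κ a α P ≠ 0 → e P = o P - (pauliOp P * ρ).trace.re) :
    (∑ P, truncatedCoeff U κ a α P * o P) - expectation U a ρ α =
      ∑ Q, a Q * ∑ ω ∈ paths U Q, pathCoeff ω α *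
        if numSines ω ≤ κ then pauliPairing (pathOp U Q ω (Fin.last m)) e
        else -(pathOp U Q ω (Fin.last m) * ρ).trace.re := by
  have h1 : ∑ P, truncatedCoeff U κ a α P * o P =
      ∑ P, truncatedCoeff U κ a α P * e P +
        ∑ P, truncatedCoeff U κ a α P * (pauliOp P * ρ).trace.re := by
    rw [← Finset.sum_add_distrib]
    refine Finset.sum_congr rfl fun P _ => ?_
    by_cases hc : truncatedCoeff U κ a α P = 0
    · simp [hc]
    · rw [he P hc]; ring
  rw [h1, sum_truncatedCoeff_mul, sum_truncatedCoeff_mul, expectation_eq,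
    ← Finset.sum_add_distrib, ← Finset.sum_sub_distrib]
  refine Finset.sum_congr rfl fun Q _ => ?_
  rw [← mul_add, ← mul_sub, retainedPaths_eq, Finset.sum_filter, Finset.sum_filter,
    ← Finset.sum_add_distrib, ← Finset.sum_sub_distrib]
  congr 1
  refine Finset.sum_congr rfl fun ω hω => ?_
  obtain ⟨R, hR⟩ := (mem_paths.1 hω).exists_isSignedPauli (Fin.last m)
  rw [hR.pauliPairing_trace]
  split_ifs <;> ring

/-- The estimate of the expectation value of `P` from a measurement record: the mean of the
single-shot estimators. -/
noncomputable def recordEstimator {N : ℕ} (d : Fin N → Shot n) (P : PauliString n) : ℝ :=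
  (∑ t, shotEstimator P (d t)) / N

theorem sum_shotProb_mul_cosh_le {ρ : QOp n} (hρ : IsState ρ) (P : PauliString n) {N : ℕ}
    (hN : 0 < N) {B : ℝ} (hB : 2 * 3 ^ weight P ≤ B) (t : ℝ) :
    ∑ d : Fin N → Shot n, (∏ i, shotProb ρ (d i)) *
        Real.cosh (t * (recordEstimator d P - (pauliOp P * ρ).trace.re)) ≤
      Real.exp (t ^ 2 * B ^ 2 / (2 * N)) := by
  have hN0 : (N : ℝ) ≠ 0 := by exact_mod_cast hN.ne'
  have h3 : (1 : ℝ) ≤ 3 ^ weight P := one_le_pow₀ (by norm_num)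
  have h := sum_prod_mul_cosh_le (p := shotProb ρ)
    (Y := fun x => shotEstimator P x - (pauliOp P * ρ).trace.re)
    (shotProb_nonneg hρ) (sum_shotProb hρ)
    (by simp only [mul_sub, Finset.sum_sub_distrib, ← Finset.sum_mul, sum_shotProb hρ,
          sum_shotProb_mul, one_mul, sub_self])
    (B := B) (by linarith)
    (fun x => by
      have h1 := abs_shotEstimator_le P x
      have h2 := abs_trace_pauliOp_mul_le_one hρ P
      have := abs_sub (shotEstimator P x) ((pauliOp P * ρ).trace.re)
      linarith) hN t
  refine le_of_eq_of_le (Finset.sum_congr rfl fun d _ => ?_) h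
  rw [Finset.sum_sub_distrib, Finset.sum_const, Finset.card_univ, Fintype.card_fin, nsmul_eq_mul,
    sub_div, mul_div_cancel_left₀ _ hN0, recordEstimator]

theorem one_sub_sum_filter_not_le_shotsProb {ρ : QOp n} (hρ : IsState ρ) {N : ℕ}
    (E : Set (Fin N → Shot n)) (F : (Fin N → Shot n) → Prop) [DecidablePred F]
    (h : ∀ d, ¬ F d → d ∈ E) :
    1 - ∑ d ∈ univ.filter F, ∏ t, shotProb ρ (d t) ≤ shotsProb ρ N E := by
  classical
  have htotal : ∑ d : Fin N → Shot n, ∏ t, shotProb ρ (d t) = 1 := by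
    rw [← Fintype.sum_pow, sum_shotProb hρ, one_pow]
  rw [← htotal, ← Finset.sum_filter_add_sum_filter_not univ F, add_sub_cancel_left, shotsProb]
  refine Finset.sum_le_sum_of_subset_of_nonneg (fun d hd => ?_)
    fun d _ _ => Finset.prod_nonneg fun t _ => shotProb_nonneg hρ _
  simp only [Finset.mem_filter, Finset.mem_univ, true_and] at hd ⊢
  exact h d hd

/-- The sampling bound behind both guarantees. A path whose Pauli string has weight at most `k` is
estimated with variance proxy `β² / N`, and the average `V` of `β²` over the random paths, rather
than its maximum, determines the number of measurements. -/
theorem shotsSuffice_of_sum_pathWeight_le {U : Circuit n m} {a : PauliString n → ℝ}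
    {A r V ε δ : ℝ} {κ k N : ℕ} (hm : 1 ≤ m) (hr : 0 < r) (ha : norm₁ a ≤ A) (hA : 0 < A)
    (hε : 0 < ε) (hδ : 0 < δ) (hδ2 : δ ≤ 1 / 2) (hκ : SufficientOrder m r a κ ε)
    (hk : ∀ α ∈ cube m r, ∀ P, k < weight P → truncatedCoeff U κ a α P = 0)
    (hV : 0 < V) (β : (Fin m → SignType) → ℝ) (hβ0 : ∀ ω, 0 < β ω)
    (hβ : ∀ Q, a Q ≠ 0 → ∀ ω, IsPath U Q ω → ∀ R,
      IsSignedPauli (pathOp U Q ω (Fin.last m)) R → weight R ≤ k → 2 * 3 ^ weight R ≤ β ω)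
    (hβV : ∀ Q, ∑ ω ∈ paths U Q, pathWeight r ω * β ω ^ 2 ≤ V)
    (hN : 16 * A ^ 2 * V / 3 * (Real.log (1 / δ) / ε) ≤ N) : ShotsSuffice U a r κ ε δ N := by
  classical
  have hlog : Real.log 2 ≤ Real.log (1 / δ) := by
    refine Real.log_le_log (by norm_num) ?_
    rw [le_div_iff₀ hδ]; linarith
  have hlog2 : 0 < Real.log 2 := Real.log_pos (by norm_num)
  have hN0 : (0 : ℝ) < N := by
    refine lt_of_lt_of_le ?_ hN
    have : 0 < Real.log (1 / δ) := hlog2.trans_le hlog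
    positivity
  have ha0 : 0 ≤ norm₁ a := Finset.sum_nonneg fun _ _ => abs_nonneg _
  refine ⟨recordEstimator, fun ρ hρ => ?_⟩
  -- errors of the estimates, discarded for the weights that do not occur
  set e : (Fin N → Shot n) → PauliString n → ℝ := fun d P =>
    if weight P ≤ k then recordEstimator d P - (pauliOp P * ρ).trace.re else 0 with he
  set f : (Σ _ : PauliString n, Fin m → SignType) → (Fin N → Shot n) → ℝ := fun i d =>
    pauliPairing (pathOp U i.1 i.2 (Fin.last m)) (e d) with hf
  set s : Finset (Σ _ : PauliString n, Fin m → SignType) :=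
    univ.sigma fun Q => paths U Q with hs
  set T : ℝ := 3 * ε / (4 * A) with hT
  have hT0 : 0 < T := by positivity
  have htail : ∑ d ∈ univ.filter (fun d : Fin N → Shot n =>
      T < ∑ i ∈ s, |a i.1| * pathWeight r i.2 * f i d ^ 2), ∏ t, shotProb ρ (d t) ≤
      2 * Real.exp (-(T / (2 * (A * V) * (1 / N)))) := by
    refine sum_filter_lt_weighted_sq_le
      (fun d => Finset.prod_nonneg fun t _ => shotProb_nonneg hρ _) s
      (w := fun i => |a i.1| * pathWeight r i.2) (B := fun i => β i.2) (e := f)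
      (fun i _ => mul_nonneg (abs_nonneg _) (pathWeight_nonneg r _)) (fun i _ => hβ0 _)
      (by positivity) hT0 ?_ ?_
    · rw [hs, Finset.sum_sigma]
      calc ∑ Q, ∑ ω ∈ paths U Q, |a Q| * pathWeight r ω * β ω ^ 2
          = ∑ Q, |a Q| * ∑ ω ∈ paths U Q, pathWeight r ω * β ω ^ 2 := by
            simp only [Finset.mul_sum, mul_assoc]
        _ ≤ ∑ Q, |a Q| * V :=
            Finset.sum_le_sum fun Q _ => mul_le_mul_of_nonneg_left (hβV Q) (abs_nonneg _)
        _ = norm₁ a * V := by rw [← Finset.sum_mul, norm₁]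
        _ ≤ A * V := mul_le_mul_of_nonneg_right ha hV.le
    · rintro ⟨Q, ω⟩ hi hw t
      have hpath : IsPath U Q ω := mem_paths.1 (Finset.mem_sigma.1 hi).2
      have haQ : a Q ≠ 0 := fun h => hw (by simp [h])
      obtain ⟨R, hR⟩ := hpath.exists_isSignedPauli (Fin.last m)
      obtain ⟨σ, hσ, -, hy⟩ := hR.exists_sign
      have hcosh : ∀ d, Real.cosh (t * f ⟨Q, ω⟩ d) = Real.cosh (t * e d R) := by
        intro d
        simp only [hf, hy]
        rcases hσ with rfl | rfl
        · rw [one_mul]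
        · rw [neg_one_mul, mul_neg, Real.cosh_neg]
      simp only [hcosh, he]
      have hexp : t ^ 2 * β ω ^ 2 * (1 / N) / 2 = t ^ 2 * β ω ^ 2 / (2 * N) := by
        field_simp
      rw [hexp]
      by_cases hwt : weight R ≤ k
      · simp only [if_pos hwt]
        exact sum_shotProb_mul_cosh_le hρ R (by exact_mod_cast hN0) (hβ Q haQ ω hpath R hR hwt) t
      · simp only [if_neg hwt, mul_zero, Real.cosh_zero, mul_one]
        rw [← Fintype.sum_pow, sum_shotProb hρ, one_pow]
        exact Real.one_le_exp (by positivity)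
  have hδbound : 2 * Real.exp (-(T / (2 * (A * V) * (1 / N)))) ≤ δ := by
    have h1 : 2 * Real.log (1 / δ) ≤ T / (2 * (A * V) * (1 / N)) := by
      have h2 : T / (2 * (A * V) * (1 / N)) = 3 * ε / (8 * A ^ 2 * V) * N := by
        rw [hT]; field_simp; ring
      rw [h2]
      calc 2 * Real.log (1 / δ) =
          3 * ε / (8 * A ^ 2 * V) * (16 * A ^ 2 * V / 3 * (Real.log (1 / δ) / ε)) := by
            field_simp; ring
        _ ≤ _ := by gcongr
    calc 2 * Real.exp (-(T / (2 * (A * V) * (1 / N))))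
        ≤ 2 * Real.exp (-(2 * Real.log (1 / δ))) := by gcongr
      _ = 2 * δ ^ 2 := by
          rw [one_div, Real.log_inv, mul_neg, neg_neg, two_mul (Real.log δ), Real.exp_add,
            Real.exp_log hδ, sq]
      _ ≤ δ := by nlinarith
  refine le_trans ?_ (one_sub_sum_filter_not_le_shotsProb hρ _
    (fun d => T < ∑ i ∈ s, |a i.1| * pathWeight r i.2 * f i d ^ 2) fun d hd => ?_)
  · linarith
  rw [not_lt] at hd
  show ∫ α, _ ∂uniformCube m r ≤ ε
  set x : PauliString n → (Fin m → SignType) → ℝ := fun Q ω =>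
    if numSines ω ≤ κ then pauliPairing (pathOp U Q ω (Fin.last m)) (e d)
    else -(pathOp U Q ω (Fin.last m) * ρ).trace.re with hx
  have hae : ∀ᵐ α ∂uniformCube m r, α ∈ cube m r :=
    ProbabilityTheory.ae_cond_mem measurableSet_Icc
  have hcongr : ∫ α, ((∑ P, truncatedCoeff U κ a α P * recordEstimator d P) -
      expectation U a ρ α) ^ 2 ∂uniformCube m r =
      ∫ α, (∑ Q, a Q * ∑ ω ∈ paths U Q, pathCoeff ω α * x Q ω) ^ 2 ∂uniformCube m r := by
    refine integral_congr_ae ?_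
    filter_upwards [hae] with α hα
    rw [surrogate_sub_expectation_eq U κ a ρ α (recordEstimator d) (e d)]
    intro P hP
    simp only [he]
    rw [if_pos (not_lt.1 fun hlt => hP (hk α hα P hlt))]
  rw [hcongr]
  refine (integral_sum_sum_paths_sq_le hr U a x).trans ?_
  -- retained and discarded paths
  have hQ : ∀ Q, ∑ ω ∈ paths U Q, pathWeight r ω * x Q ω ^ 2 ≤
      ∑ ω ∈ paths U Q, pathWeight r ω * f ⟨Q, ω⟩ d ^ 2 +
        (Real.exp 1 * m * r ^ 2 / (3 * κ)) ^ κ := by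
    intro Q
    refine le_trans ?_ (add_le_add_right (sum_pathWeight_tail_le hr hm U Q hκ.1 hκ.2.1) _)
    rw [Finset.sum_filter, ← Finset.sum_add_distrib]
    refine Finset.sum_le_sum fun ω hω => ?_
    obtain ⟨R, hR⟩ := (mem_paths.1 hω).exists_isSignedPauli (Fin.last m)
    have hW := pathWeight_nonneg r ω
    by_cases hsin : numSines ω ≤ κ
    · simp [hx, hf, hsin]
    · simp only [hx, hsin, if_false, not_false_eq_true, if_true, neg_sq]
      have h1 : (pathOp U Q ω (Fin.last m) * ρ).trace.re ^ 2 ≤ 1 := by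
        rw [sq_le_one_iff_abs_le_one]
        exact hR.abs_trace_le_one hρ
      have h2 : 0 ≤ pathWeight r ω * f ⟨Q, ω⟩ d ^ 2 := by positivity
      nlinarith
  have hsum : ∑ Q, |a Q| * ∑ ω ∈ paths U Q, pathWeight r ω * f ⟨Q, ω⟩ d ^ 2 ≤ T := by
    refine le_of_eq_of_le ?_ hd
    rw [hs, Finset.sum_sigma]
    simp only [Finset.mul_sum, mul_assoc]
  set τ := (Real.exp 1 * m * r ^ 2 / (3 * κ)) ^ κ with hτ
  calc norm₁ a * ∑ Q, |a Q| * ∑ ω ∈ paths U Q, pathWeight r ω * x Q ω ^ 2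
      ≤ norm₁ a * ∑ Q, |a Q| * (∑ ω ∈ paths U Q, pathWeight r ω * f ⟨Q, ω⟩ d ^ 2 + τ) := by
        gcongr with Q _
        exact hQ Q
    _ = norm₁ a * ∑ Q, |a Q| * (∑ ω ∈ paths U Q, pathWeight r ω * f ⟨Q, ω⟩ d ^ 2) +
          norm₁ a ^ 2 * τ := by
        simp only [mul_add, Finset.sum_add_distrib, ← Finset.sum_mul]
        rw [← norm₁]; ring
    _ ≤ A * T + ε / 4 := by
        refine add_le_add ?_ (by linarith [hκ.2.2])
        calc _ ≤ norm₁ a * T := mul_le_mul_of_nonneg_left hsum ha0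
          _ ≤ A * T := mul_le_mul_of_nonneg_right ha hT0.le
    _ = ε := by rw [hT]; field_simp; norm_num

/-! ### The cost of the truncated propagation -/

theorem propagationCost_le (U : Circuit n m) (κ : ℕ) (a : PauliString n → ℝ) {X : ℝ}
    (h : ∀ Q, ((retainedPaths U κ Q).card : ℝ) ≤ X) :
    (propagationCost U κ a : ℝ) ≤ numPaulis a * m * X := by
  rw [propagationCost, numPaulis]
  push_cast
  calc _ ≤ ∑ Q ∈ univ.filter (fun Q => a Q ≠ 0), (m : ℝ) * X :=
        Finset.sum_le_sum fun Q _ => mul_le_mul_of_nonneg_left (h Q) (Nat.cast_nonneg _)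
    _ = _ := by rw [Finset.sum_const, nsmul_eq_mul, mul_assoc]

theorem propagationCost_le_of_le (U : Circuit n m) {κ : ℕ} (a : PauliString n → ℝ) (hκ : 1 ≤ κ)
    (hκm : κ ≤ m) :
    (propagationCost U κ a : ℝ) ≤ numPaulis a * m * (Real.exp 1 * m / κ) ^ κ :=
  propagationCost_le U κ a fun Q => card_retainedPaths_le U Q hκ hκm

theorem exp_one_div_pow_le (κ : ℕ) (hκ : 1 ≤ κ) : (Real.exp 1 / κ) ^ κ ≤ 3 := by
  have hκ0 : (0 : ℝ) < κ := by exact_mod_cast hκ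
  -- `(e / κ) ^ κ ≤ e`, because `log κ ≥ 1 - 1 / κ`
  have h1 : Real.exp 1 / κ ≤ Real.exp (1 / κ) := by
    have h := Real.add_one_le_exp (1 / (κ : ℝ) - 1)
    rw [Real.exp_sub, le_div_iff₀ (Real.exp_pos 1)] at h
    calc Real.exp 1 / κ = (1 / (κ : ℝ) - 1 + 1) * Real.exp 1 := by ring
      _ ≤ _ := h
  calc (Real.exp 1 / κ) ^ κ ≤ Real.exp (1 / κ) ^ κ :=
        pow_le_pow_left₀ (by positivity) h1 κ
    _ = Real.exp 1 := by
        rw [← Real.exp_nat_mul]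
        congr 1
        field_simp
    _ ≤ 3 := by linarith [Real.exp_one_lt_d9]

/-- The cost is polynomial of degree `κ + 1` in the number of layers. When `κ > m`, all of the at
most `2 ^ m` paths may be retained. -/
theorem propagationCost_le_pow (U : Circuit n m) {κ : ℕ} (a : PauliString n → ℝ) (hκ : 1 ≤ κ)
    (hm : 1 ≤ m) : (propagationCost U κ a : ℝ) ≤ 3 * (numPaulis a * (m : ℝ) ^ (κ + 1)) := by
  have hm1 : (1 : ℝ) ≤ m := by exact_mod_cast hm
  have hN : (0 : ℝ) ≤ numPaulis a := Nat.cast_nonneg _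
  suffices h : ∀ Q, ((retainedPaths U κ Q).card : ℝ) ≤ 3 * (m : ℝ) ^ κ by
    refine (propagationCost_le U κ a h).trans_eq ?_
    rw [pow_succ]; ring
  intro Q
  by_cases hκm : κ ≤ m
  · refine (card_retainedPaths_le U Q hκ hκm).trans ?_
    rw [mul_div_right_comm, mul_pow]
    exact mul_le_mul_of_nonneg_right (exp_one_div_pow_le κ hκ) (by positivity)
  · have h1 : ((retainedPaths U κ Q).card : ℝ) ≤ 2 ^ m := by
      refine le_trans ?_ (card_paths_le U Q)
      rw [retainedPaths_eq]
      exact_mod_cast Finset.card_filter_le _ _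
    refine h1.trans ?_
    rcases hm.eq_or_lt with rfl | hm2
    · norm_num
    · have hm2' : (2 : ℝ) ≤ m := by exact_mod_cast hm2
      calc (2 : ℝ) ^ m ≤ (m : ℝ) ^ m := by gcongr
        _ ≤ (m : ℝ) ^ κ := pow_le_pow_right₀ hm1 (by omega)
        _ ≤ 3 * (m : ℝ) ^ κ := by
            have : (0 : ℝ) ≤ (m : ℝ) ^ κ := by positivity
            linarith

theorem mul_sq_le_of_le_div_sqrt {c r : ℝ} (hr : 0 < r) (h : r ≤ c / √(m : ℝ)) :
    (m : ℝ) * r ^ 2 ≤ c ^ 2 := by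
  rcases Nat.eq_zero_or_pos m with rfl | hm
  · simpa using sq_nonneg c
  have hm0 : (0 : ℝ) < m := by exact_mod_cast hm
  rw [le_div_iff₀ (Real.sqrt_pos.2 hm0)] at h
  calc (m : ℝ) * r ^ 2 = (r * √(m : ℝ)) ^ 2 := by
        rw [mul_pow, Real.sq_sqrt hm0.le, mul_comm]
    _ ≤ c ^ 2 := pow_le_pow_left₀ (by positivity) h 2

/-- For small `ε`, a truncation order slightly below `log (1 / ε)` makes the truncation error
smaller than `ε`, since the error decays faster than exponentially in the order. -/
theorem exists_order (A c : ℝ) : ∃ ε₀ : ℝ, 0 < ε₀ ∧ ∀ ε : ℝ, 0 < ε → ε ≤ ε₀ → ∃ κ : ℕ,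
    1 ≤ κ ∧ (κ : ℝ) + 1 ≤ Real.log (1 / ε) ∧ c ^ 2 ≤ 3 * κ ∧
      4 * A ^ 2 * (Real.exp 1 * c ^ 2 / (3 * κ)) ^ κ ≤ ε := by
  set L₀ : ℝ := 4 + 2 * (Real.exp 5 * c ^ 2) + 4 * A ^ 2 with hL₀
  refine ⟨Real.exp (-L₀), Real.exp_pos _, fun ε hε hεε₀ => ?_⟩
  set L := Real.log (1 / ε) with hL
  have hεL : ε = Real.exp (-L) := by
    rw [hL, one_div, Real.log_inv, neg_neg, Real.exp_log hε]
  have hLL₀ : L₀ ≤ L := by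
    rw [hεL] at hεε₀
    linarith [Real.exp_le_exp.1 hεε₀]
  have hc5 : 0 ≤ Real.exp 5 * c ^ 2 := by positivity
  have hA2 : 0 ≤ 4 * A ^ 2 := by positivity
  have hfloor1 := Nat.floor_le (show 0 ≤ L by linarith)
  have hfloor2 := Nat.lt_floor_add_one L
  have hfloor3 : 4 ≤ ⌊L⌋₊ := Nat.le_floor (by push_cast; linarith)
  obtain ⟨κ, hκ⟩ : ∃ κ, ⌊L⌋₊ = κ + 1 := ⟨⌊L⌋₊ - 1, by omega⟩
  rw [hκ] at hfloor1 hfloor2 hfloor3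
  push_cast at hfloor1 hfloor2
  have hκ1 : 1 ≤ κ := by omega
  have hκ0 : (0 : ℝ) < κ := by exact_mod_cast hκ1
  have hκL : L / 2 ≤ κ := by linarith
  have hκc : Real.exp 5 * c ^ 2 ≤ 3 * κ := by linarith
  refine ⟨κ, hκ1, hfloor1, ?_, ?_⟩
  · have h5 : 1 ≤ Real.exp 5 := Real.one_le_exp (by norm_num)
    nlinarith [sq_nonneg c]
  · have hbase : Real.exp 1 * c ^ 2 / (3 * κ) ≤ Real.exp (-4) := by
      rw [div_le_iff₀ (by positivity)]
      calc Real.exp 1 * c ^ 2 = Real.exp (-4) * (Real.exp 5 * c ^ 2) := by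
            rw [← mul_assoc, ← Real.exp_add]; norm_num
        _ ≤ Real.exp (-4) * (3 * κ) := mul_le_mul_of_nonneg_left hκc (Real.exp_nonneg _)
    have hpow : (Real.exp 1 * c ^ 2 / (3 * κ)) ^ κ ≤ Real.exp (-(2 * L)) := by
      calc _ ≤ Real.exp (-4) ^ κ := pow_le_pow_left₀ (by positivity) hbase κ
        _ = Real.exp (κ * (-4)) := by rw [← Real.exp_nat_mul]
        _ ≤ Real.exp (-(2 * L)) := Real.exp_le_exp.2 (by linarith)
    have hAL : 4 * A ^ 2 ≤ Real.exp L := by linarith [Real.add_one_le_exp L]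
    calc _ ≤ Real.exp L * Real.exp (-(2 * L)) :=
          mul_le_mul hAL hpow (by positivity) (Real.exp_nonneg _)
      _ = ε := by
          rw [hεL, ← Real.exp_add]; congr 1; ring

theorem exists_order_cost {A c : ℝ} :
    ∃ ε₀ : ℝ, 0 < ε₀ ∧ ∀ ε : ℝ, 0 < ε → ε ≤ ε₀ → ∃ κ : ℕ,
      ∀ (n m : ℕ) (U : Circuit n m) (a : PauliString n → ℝ) (r : ℝ),
        1 ≤ m → norm₁ a ≤ A → 0 < r → r ≤ c / √(m : ℝ) →
        SufficientOrder m r a κ ε ∧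
        (κ ≤ m → (propagationCost U κ a : ℝ) ≤
          numPaulis a * m * (Real.exp 1 * m / κ) ^ κ) ∧
        (propagationCost U κ a : ℝ) ≤ 3 * (numPaulis a * (m : ℝ) ^ Real.log (1 / ε)) := by
  obtain ⟨ε₀, hε₀, h⟩ := exists_order A c
  refine ⟨ε₀, hε₀, fun ε hε hεε₀ => ?_⟩
  obtain ⟨κ, hκ, hκL, hκc, hκε⟩ := h ε hε hεε₀
  refine ⟨κ, fun n m U a r hm ha hr hrc => ⟨⟨hκ, ?_, ?_⟩, ?_, ?_⟩⟩
  · exact (mul_sq_le_of_le_div_sqrt hr hrc).trans hκc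
  · refine le_trans ?_ hκε
    have ha0 : 0 ≤ norm₁ a := Finset.sum_nonneg fun _ _ => abs_nonneg _
    have hmr := mul_sq_le_of_le_div_sqrt hr hrc
    rw [mul_assoc (Real.exp 1)]
    gcongr
  · exact fun hκm => propagationCost_le_of_le U a hκ hκm
  · have hm1 : (1 : ℝ) ≤ m := by exact_mod_cast hm
    refine (propagationCost_le_pow U a hκ hm).trans ?_
    gcongr
    rw [← Real.rpow_natCast]
    exact Real.rpow_le_rpow_of_exponent_le hm1 (by push_cast; exact hκL)

/-! ### The number of measurements -/

/-- The logarithmic factor in the number of measurements is only needed to be at least `log 2`. -/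
theorem le_of_mul_min_log_le {a : PauliString n → ℝ} (hn : 2 ≤ n) (hm : 2 ≤ m * numPaulis a)
    {K ε δ : ℝ} (hK : 0 < K) (hε : 0 < ε) (hδ : 0 < δ) (hδ2 : δ ≤ 1 / 2) {N : ℕ}
    (hN : K / Real.log 2 * (min (Real.log n) (Real.log (m * numPaulis a)) *
      Real.log (1 / δ) / ε) ≤ N) : K * (Real.log (1 / δ) / ε) ≤ N := by
  have hlog2 : 0 < Real.log 2 := Real.log_pos (by norm_num)
  have hmin : Real.log 2 ≤ min (Real.log n) (Real.log (m * numPaulis a)) := by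
    refine le_min (Real.log_le_log (by norm_num) (by exact_mod_cast hn))
      (Real.log_le_log (by norm_num) (by exact_mod_cast hm))
  have hlog : 0 ≤ Real.log (1 / δ) := by
    refine Real.log_nonneg ?_
    rw [le_div_iff₀ hδ]; linarith
  refine le_trans ?_ hN
  calc K * (Real.log (1 / δ) / ε) = K / Real.log 2 * (Real.log 2 * Real.log (1 / δ) / ε) := by
        field_simp
    _ ≤ _ := by gcongr

/-- Truncated observables of constant weight: all Pauli strings share the variance proxy. -/
theorem shotsSuffice_of_weight_le {U : Circuit n m} {a : PauliString n → ℝ}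
    {A r ε δ : ℝ} {κ k N : ℕ} (hm : 1 ≤ m) (hr : 0 < r) (ha : norm₁ a ≤ A) (hA : 0 < A)
    (hε : 0 < ε) (hδ : 0 < δ) (hδ2 : δ ≤ 1 / 2) (hκ : SufficientOrder m r a κ ε)
    (hk : ∀ α ∈ cube m r, ∀ P, k < weight P → truncatedCoeff U κ a α P = 0)
    (hN : 16 * A ^ 2 * (2 * 3 ^ k) ^ 2 / 3 * (Real.log (1 / δ) / ε) ≤ N) :
    ShotsSuffice U a r κ ε δ N := by
  refine shotsSuffice_of_sum_pathWeight_le hm hr ha hA hε hδ hδ2 hκ hk (by positivity)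
    (fun _ => 2 * 3 ^ k) (fun _ => by positivity) (fun Q _ ω _ R _ hR => ?_) (fun Q => ?_) hN
  · gcongr
    norm_num
  · rw [← Finset.sum_mul, sum_pathWeight hr, one_mul]

theorem truncatedCoeff_eq_zero_of_weight {U : Circuit n m} {a : PauliString n → ℝ} {κ w l : ℕ}
    (hC : ∀ i, IsSingleQubitCliffordLayer (U.clifford i)) (hl : ∀ i, weight (U.generator i) ≤ l)
    (hw : ∀ P, a P ≠ 0 → weight P ≤ w) (α : Fin m → ℝ) {P : PauliString n}
    (hP : w + κ * l < weight P) : truncatedCoeff U κ a α P = 0 := by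
  rw [truncatedCoeff_eq]
  refine Finset.sum_eq_zero fun Q _ => ?_
  by_cases haQ : a Q = 0
  · rw [haQ, zero_mul]
  rw [Finset.sum_eq_zero, mul_zero]
  intro ω hω
  rw [retainedPaths_eq, Finset.mem_filter, mem_paths] at hω
  obtain ⟨R, hR⟩ := hω.1.exists_isSignedPauli (Fin.last m)
  have hwR := hω.1.weight_le hC hl hR
  have hne : P ≠ R := by
    rintro rfl
    have := Nat.mul_le_mul_right l hω.2
    have := hw Q haQ
    omega
  obtain ⟨s, -, -, h⟩ := hR.exists_sum_coeff_eq
  rw [h, if_neg hne, mul_zero]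

/-- Single-qubit Clifford layers: the weight, and with it the variance of the estimate, grows with
the number of sines of a path, but paths with many sines have super-exponentially small weight. -/
theorem shotsSuffice_of_singleQubitClifford {U : Circuit n m} {a : PauliString n → ℝ}
    {A c r ε δ : ℝ} {κ w l N : ℕ} (hm : 1 ≤ m) (hr : 0 < r) (hrc : r ≤ c / √(m : ℝ))
    (ha : norm₁ a ≤ A) (hA : 0 < A)
    (hε : 0 < ε) (hδ : 0 < δ) (hδ2 : δ ≤ 1 / 2) (hκ : SufficientOrder m r a κ ε)
    (hC : ∀ i, IsSingleQubitCliffordLayer (U.clifford i)) (hl : ∀ i, weight (U.generator i) ≤ l)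
    (hw : ∀ P, a P ≠ 0 → weight P ≤ w)
    (hN : 16 * A ^ 2 * (4 * 9 ^ w * Real.exp (c ^ 2 * 9 ^ l / 3)) / 3 *
      (Real.log (1 / δ) / ε) ≤ N) : ShotsSuffice U a r κ ε δ N := by
  refine shotsSuffice_of_sum_pathWeight_le hm hr ha hA hε hδ hδ2 hκ
    (fun α _ P hP => truncatedCoeff_eq_zero_of_weight hC hl hw α hP) (by positivity)
    (fun ω => 2 * 3 ^ (w + numSines ω * l)) (fun _ => by positivity)
    (fun Q hQ ω hω R hR _ => ?_) (fun Q => ?_) hN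
  · have := hω.weight_le hC hl hR
    have := hw Q hQ
    gcongr
    · norm_num
    · omega
  · have hterm : ∀ ω : Fin m → SignType, pathWeight r ω * (2 * 3 ^ (w + numSines ω * l)) ^ 2 =
        4 * 9 ^ w * (pathWeight r ω * (9 ^ l) ^ numSines ω) := by
      intro ω
      have h9 : ∀ j : ℕ, (9 : ℝ) ^ j = (3 ^ j) ^ 2 := fun j => by
        rw [← pow_mul, mul_comm, pow_mul]
        norm_num
      rw [← pow_mul, h9 w, h9 (l * numSines ω)]
      ring
    simp only [hterm]
    rw [← Finset.mul_sum]
    gcongr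
    refine (sum_pathWeight_mul_pow_le hr U Q (one_le_pow₀ (by norm_num))).trans ?_
    have := mul_sq_le_of_le_div_sqrt hr hrc
    gcongr

end ShadowSurrogation

open ShadowSurrogation in
theorem theorem4 (A c : ℝ) (hA : 0 < A) (hc : 0 < c) :
    -- Sufficient truncation orders, and the cost of the classical propagation.
    (∃ ε₀ : ℝ, 0 < ε₀ ∧ ∀ ε : ℝ, 0 < ε → ε ≤ ε₀ → ∃ κ : ℕ,
      ∀ (n m : ℕ) (U : Circuit n m) (a : PauliString n → ℝ) (r : ℝ),
        1 ≤ m → norm₁ a ≤ A → 0 < r → r ≤ c / √(m : ℝ) →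
        SufficientOrder m r a κ ε ∧
        (κ ≤ m → (propagationCost U κ a : ℝ) ≤
          numPaulis a * m * (Real.exp 1 * m / κ) ^ κ) ∧
        (propagationCost U κ a : ℝ) ≤ 3 * (numPaulis a * (m : ℝ) ^ Real.log (1 / ε))) ∧
    -- Truncated back-propagated observables of constant Pauli weight.
    (∀ k : ℕ, ∃ K : ℝ, 0 < K ∧
      ∀ (n m : ℕ) (U : Circuit n m) (a : PauliString n → ℝ) (r : ℝ) (κ : ℕ) (ε δ : ℝ),
        2 ≤ n → 2 ≤ m * numPaulis a → norm₁ a ≤ A → 0 < r → r ≤ c / √(m : ℝ) →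
        0 < ε → 0 < δ → δ ≤ 1 / 2 → SufficientOrder m r a κ ε →
        (∀ α ∈ cube m r, ∀ P, k < weight P → truncatedCoeff U κ a α P = 0) →
        ∀ N : ℕ,
          K * (min (Real.log n) (Real.log (m * numPaulis a)) * Real.log (1 / δ) / ε) ≤ N →
          ShotsSuffice U a r κ ε δ N) ∧
    -- Single-qubit Clifford gates and local rotations.
    (∀ w l : ℕ, ∃ K : ℝ, 0 < K ∧
      ∀ (n m : ℕ) (U : Circuit n m) (a : PauliString n → ℝ) (r : ℝ) (κ : ℕ) (ε δ : ℝ),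
        2 ≤ n → 2 ≤ m * numPaulis a → norm₁ a ≤ A → 0 < r → r ≤ c / √(m : ℝ) →
        0 < ε → 0 < δ → δ ≤ 1 / 2 → SufficientOrder m r a κ ε →
        (∀ i, IsSingleQubitCliffordLayer (U.clifford i)) →
        (∀ i, weight (U.generator i) ≤ l) →
        (∀ P, a P ≠ 0 → weight P ≤ w) →
        (∀ α P, w + κ * l < weight P → truncatedCoeff U κ a α P = 0) ∧
        ∀ N : ℕ,
          K * (min (Real.log n) (Real.log (m * numPaulis a)) * Real.log (1 / δ) / ε) ≤ N →
          ShotsSuffice U a r κ ε δ N) := by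
  have one_le : ∀ {m N : ℕ}, 2 ≤ m * N → 1 ≤ m := fun {m N} h =>
    Nat.pos_of_ne_zero fun h0 => by simp [h0] at h
  have hlog2 : 0 < Real.log 2 := Real.log_pos (by norm_num)
  refine ⟨exists_order_cost, fun k => ?_, fun w l => ?_⟩
  · refine ⟨16 * A ^ 2 * (2 * 3 ^ k) ^ 2 / 3 / Real.log 2, by positivity, ?_⟩
    intro n m U a r κ ε δ hn hm ha hr _ hε hδ hδ2 hκ hk N hN
    exact shotsSuffice_of_weight_le (one_le hm) hr ha hA hε hδ hδ2 hκ hk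
      (le_of_mul_min_log_le hn hm (by positivity) hε hδ hδ2 hN)
  · refine ⟨16 * A ^ 2 * (4 * 9 ^ w * Real.exp (c ^ 2 * 9 ^ l / 3)) / 3 / Real.log 2,
      by positivity, ?_⟩
    intro n m U a r κ ε δ hn hm ha hr hrc hε hδ hδ2 hκ hC hl hw
    exact ⟨fun α P hP => truncatedCoeff_eq_zero_of_weight hC hl hw α hP, fun N hN =>
      shotsSuffice_of_singleQubitClifford (one_le hm) hr hrc ha hA hε hδ hδ2 hκ hC hl hw
        (le_of_mul_min_log_le hn hm (by positivity) hε hδ hδ2 hN)⟩
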